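/- Let $U\subseteq\mathbb R^2$ be open, let $A$ be a real Lie algebra of smooth vector fields on $U$, and let $N\ge 2$. Suppose $A=S\oplus R$ is a Levi decomposition ($R$ the radical of $A$, $S$ a subalgebra complementary to $R$), where $S$ has a basis $X,Y,H$ with $[X,Y]=H$, $[H,X]=2X$, $[H,Y]=-2Y$, and suppose that, as a representation of $S$, $R$ is the direct sum of an irreducible representation $W$ of dimension $N$ and a representation of dimension $1$. Let $V\in W$ be a highest weight vector relative to $\langle H,X\rangle$, i.e. $V\neq 0$, $[X,V]=0$ and $V$ is an eigenvector of $\operatorname{ad}H$. Call rank of a space of vector fields the maximal dimension, over all points $q\in U$, of the space of its values at $q$. Assume that $R$ has rank $1$ and $\langle X,V\rangle$ has rank $2$. Let $p\in U$ be a point at which $X,V$ are linearly independent and such that no nonzero element of $A$ vanishes identically near $p$ (that is, $A$ is an algebra of local vector fields at $p$). Then there are smooth coordinates on a connected open neighbourhood of $p$ in $U$ in which $X=\partial_x$ and $V=\partial_y$ (canonical coordinates for $\langle X,V\rangle$). Moreover, for any such coordinates there is a translation $(x,y)\mapsto(x+c_1,y+c_2)$ after which, denoting the new coordinates again by $(x,y)$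 and by $D\subseteq\mathbb R^2$ the open set of their values: (1) $S$ and $R$, expressed in these coordinates, are the restrictions to $D$ of $$\langle\partial_x,\ x^2\partial_x+(N-1)xy\,\partial_y,\ 2x\partial_x+(N-1)y\,\partial_y\rangle\quad\text{and}\quad\langle\partial_y,\ x\partial_y,\ \dots,\ x^{N-1}\partial_y,\ y\partial_y\rangle ;$$ (2) if $N\ge 3$, then $A$, expressed in these coordinates, is exactly the Lie algebra of all infinitesimal point symmetries on $D$ of the equation $y^{(N)}=0$, i.e. of all smooth vector fields on $D$ whose $N$-th prolongation is tangent to the hypersurface $y^{(N)}=0$ at all its points over $D$; (3) $y^{(N)}=0$ is the only hypersurface of the form $y^{(N)}=f(x,y,y',\dots,y^{(N-1)})$ invariant under $A$: for every open set $\Omega$ of values $(x,y,y',\dots,y^{(N-1)})$ with $(x,y)\in D$ and every differentiable $f:\Omega\to\mathbb R$, the $N$-th prolongations of all elements of $A$ annihilate $y^{(N)}-f$ at every point of the hypersurface $y^{(N)}=f$ over $\Omega$ if and only if $f=0$ on $\Omega$. -/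

import Mathlib

open Set Filter Topology TopologicalSpace VectorField
open scoped ContDiff

noncomputable section

/-! ### Smooth vector fields on an open subset of the plane -/

/-- The plane, with coordinates `(x, y)`. -/
abbrev Plane : Type := ℝ × ℝ

/-- The space of smooth vector fields on the open set `U`. A field is recorded as a map
`Plane → Plane` (component `1` is the coefficient of `∂x`, component `2` that of `∂y`) which is
smooth on `U`; the value `0` outside `U` is only a normalisation, so that two fields are equal
exactly when they agree on `U`. -/
def PlaneField (U : Opens Plane) : Submodule ℝ (Plane → Plane) where
  carrier := {v | ContDiffOn ℝ ∞ v U ∧ ∀ q, q ∉ U → v q = 0}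
  add_mem' := fun {v w} hv hw =>
    ⟨hv.1.add hw.1, fun q hq => by simp [hv.2 q hq, hw.2 q hq]⟩
  zero_mem' := ⟨contDiffOn_const, fun _ _ => rfl⟩
  smul_mem' := fun c v hv => ⟨contDiffOn_const.smul hv.1, fun q hq => by simp [hv.2 q hq]⟩

namespace PlaneField

variable {U : Opens Plane}

instance : CoeFun (PlaneField U) (fun _ => Plane → Plane) := ⟨fun v => v.1⟩

protected theorem contDiffAt (v : PlaneField U) {q : Plane} (hq : q ∈ U) : ContDiffAt ℝ ∞ v q :=
  v.2.1.contDiffAt (U.isOpen.mem_nhds hq)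

protected theorem differentiableAt (v : PlaneField U) {q : Plane} (hq : q ∈ U) :
    DifferentiableAt ℝ v q :=
  (PlaneField.contDiffAt v hq).differentiableAt (by simp)

theorem ext_on {v w : PlaneField U} (h : ∀ q ∈ U, v q = w q) : v = w := by
  apply Subtype.ext
  funext q
  by_cases hq : q ∈ U
  · exact h q hq
  · rw [v.2.2 q hq, w.2.2 q hq]

open Classical in
/-- The field on `U` given by a function that is smooth on `U` (its values off `U` are discarded). -/
def ofFun (f : Plane → Plane) (hf : ContDiffOn ℝ ∞ f U) : PlaneField U :=
  ⟨fun q => if q ∈ U then f q else 0,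
    hf.congr fun q (hq : q ∈ U) => by simp [hq], fun q hq => by simp [hq]⟩

theorem ofFun_apply (f : Plane → Plane) (hf : ContDiffOn ℝ ∞ f U) {q : Plane} (hq : q ∈ U) :
    ofFun f hf q = f q := by
  simp [ofFun, hq]

theorem ofFun_eventuallyEq (f : Plane → Plane) (hf : ContDiffOn ℝ ∞ f U) {q : Plane}
    (hq : q ∈ U) : (ofFun f hf : Plane → Plane) =ᶠ[𝓝 q] f := by
  filter_upwards [U.isOpen.mem_nhds hq] with z hz
  exact ofFun_apply f hf hz

theorem contDiffOn_lieBracket (v w : PlaneField U) : ContDiffOn ℝ ∞ (lieBracket ℝ v w) U :=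
  fun _ hq => ((PlaneField.contDiffAt v hq).lieBracket_vectorField (PlaneField.contDiffAt w hq)
    (m := ∞) (n := ∞) (by simp)).contDiffWithinAt

/-- The usual bracket of vector fields, `[v, w] = Dw(v) - Dv(w)` in coordinates, that is
`[v, w] f = v (w f) - w (v f)` on functions. -/
instance : Bracket (PlaneField U) (PlaneField U) where
  bracket v w := ofFun (lieBracket ℝ v w) (contDiffOn_lieBracket v w)

theorem bracket_apply (v w : PlaneField U) {q : Plane} (hq : q ∈ U) :
    (⁅v, w⁆ : PlaneField U) q = lieBracket ℝ v w q :=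
  ofFun_apply _ _ hq

theorem bracket_eventuallyEq (v w : PlaneField U) {q : Plane} (hq : q ∈ U) :
    ((⁅v, w⁆ : PlaneField U) : Plane → Plane) =ᶠ[𝓝 q] lieBracket ℝ v w :=
  ofFun_eventuallyEq _ _ hq

instance : LieRing (PlaneField U) where
  add_lie u v w := ext_on fun q hq => by
    change _ = (⁅u, w⁆ : PlaneField U) q + (⁅v, w⁆ : PlaneField U) q
    rw [bracket_apply _ _ hq, bracket_apply _ _ hq, bracket_apply _ _ hq]
    exact lieBracket_add_left (PlaneField.differentiableAt u hq) (PlaneField.differentiableAt v hq)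
  lie_add u v w := ext_on fun q hq => by
    change _ = (⁅u, v⁆ : PlaneField U) q + (⁅u, w⁆ : PlaneField U) q
    rw [bracket_apply _ _ hq, bracket_apply _ _ hq, bracket_apply _ _ hq]
    exact lieBracket_add_right (PlaneField.differentiableAt v hq) (PlaneField.differentiableAt w hq)
  lie_self u := ext_on fun q hq => by
    rw [bracket_apply _ _ hq, lieBracket_self]; rfl
  leibniz_lie u v w := ext_on fun q hq => by
    change _ = (⁅⁅u, v⁆, w⁆ : PlaneField U) q + (⁅v, ⁅u, w⁆⁆ : PlaneField U) q
    rw [bracket_apply _ _ hq, bracket_apply _ _ hq, bracket_apply _ _ hq,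
      (EventuallyEq.refl _ _).lieBracket_vectorField_eq (bracket_eventuallyEq v w hq),
      (bracket_eventuallyEq u v hq).lieBracket_vectorField_eq (EventuallyEq.refl _ _),
      (EventuallyEq.refl _ _).lieBracket_vectorField_eq (bracket_eventuallyEq u w hq)]
    exact leibniz_identity_lieBracket (n := ∞)
      (by rw [minSmoothness_of_isRCLikeNormedField]; exact ENat.LEInfty.out) (PlaneField.contDiffAt u hq)
      (PlaneField.contDiffAt v hq) (PlaneField.contDiffAt w hq)

instance : LieAlgebra ℝ (PlaneField U) where
  lie_smul c v w := ext_on fun q hq => by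
    change _ = c • (⁅v, w⁆ : PlaneField U) q
    rw [bracket_apply _ _ hq, bracket_apply _ _ hq]
    exact lieBracket_const_smul_right (PlaneField.differentiableAt w hq)

/-- Evaluation of vector fields at a point. -/
def evalAt (U : Opens Plane) (q : Plane) : PlaneField U →ₗ[ℝ] Plane where
  toFun v := v q
  map_add' _ _ := rfl
  map_smul' _ _ := rfl

/-- The rank of a space of vector fields: the largest dimension, over all points `q` of `U`, of the
space of its values at `q`. (For a finite-dimensional Lie algebra of fields this space of values
is the tangent space at `q` of the orbit, so the rank is the dimension of a generic orbit.) -/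
def rank (L : Submodule ℝ (PlaneField U)) : ℕ :=
  ⨆ q : U, Module.finrank ℝ (L.map (evalAt U q))

end PlaneField

/-! ### Charts and canonical coordinates -/

/-- A smooth coordinate system on an open subset (`source`) of `U`: a smooth diffeomorphism of
`source` onto an open subset (`target`) of the plane. -/
structure PlaneChart (U : Opens Plane) where
  toHomeo : OpenPartialHomeomorph Plane Plane
  source_subset : toHomeo.source ⊆ U
  contDiffOn_toFun : ContDiffOn ℝ ∞ toHomeo toHomeo.source
  contDiffOn_symm : ContDiffOn ℝ ∞ toHomeo.symm toHomeo.target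

namespace PlaneChart

variable {U : Opens Plane}

/-- The open subset of the plane on which the coordinates take their values. -/
def domain (φ : PlaneChart U) : Opens Plane := ⟨φ.toHomeo.target, φ.toHomeo.open_target⟩

theorem contDiffOn_pushforward (φ : PlaneChart U) (v : PlaneField U) :
    ContDiffOn ℝ ∞ (fun z => fderiv ℝ φ.toHomeo (φ.toHomeo.symm z) (v (φ.toHomeo.symm z)))
      φ.domain := by
  have hmaps : MapsTo φ.toHomeo.symm φ.domain φ.toHomeo.source := φ.toHomeo.mapsTo_symm
  have h1 : ContDiffOn ℝ ∞ (fderiv ℝ φ.toHomeo) φ.toHomeo.source :=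
    φ.contDiffOn_toFun.fderiv_of_isOpen φ.toHomeo.open_source (by simp)
  exact (h1.comp φ.contDiffOn_symm hmaps).clm_apply
    ((v.2.1.mono φ.source_subset).comp φ.contDiffOn_symm hmaps)

/-- The expression of a vector field in the coordinates `φ`: the pushforward
`z ↦ Dφ(φ⁻¹ z) (v (φ⁻¹ z))` of (the restriction to the source of) `v`. -/
def push (φ : PlaneChart U) : PlaneField U →ₗ[ℝ] PlaneField φ.domain where
  toFun v := PlaneField.ofFun _ (φ.contDiffOn_pushforward v)
  map_add' v w := PlaneField.ext_on fun z hz => by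
    change _ = PlaneField.ofFun _ (φ.contDiffOn_pushforward v) z
      + PlaneField.ofFun _ (φ.contDiffOn_pushforward w) z
    rw [PlaneField.ofFun_apply _ _ hz, PlaneField.ofFun_apply _ _ hz,
      PlaneField.ofFun_apply _ _ hz]
    exact (fderiv ℝ φ.toHomeo (φ.toHomeo.symm z)).map_add _ _
  map_smul' c v := PlaneField.ext_on fun z hz => by
    change _ = c • PlaneField.ofFun _ (φ.contDiffOn_pushforward v) z
    rw [PlaneField.ofFun_apply _ _ hz, PlaneField.ofFun_apply _ _ hz]
    exact (fderiv ℝ φ.toHomeo (φ.toHomeo.symm z)).map_smul c _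

/-- The coordinates obtained from `φ` by the affine change `(x, y) ↦ (x + c.1, y + c.2)`. -/
def translate (φ : PlaneChart U) (c : Plane) : PlaneChart U where
  toHomeo := φ.toHomeo.transHomeomorph (Homeomorph.addRight c)
  source_subset := φ.source_subset
  contDiffOn_toFun := φ.contDiffOn_toFun.add contDiffOn_const
  contDiffOn_symm := by
    refine φ.contDiffOn_symm.comp (g := φ.toHomeo.symm) (f := fun z => z + -c)
      (contDiff_id.add contDiff_const).contDiffOn ?_
    exact fun z hz => hz

/-- `φ` is a system of canonical coordinates for `⟨X, V⟩`: it turns `X` into `∂x` and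
`V` into `∂y`. -/
def IsCanonical (φ : PlaneChart U) (X V : PlaneField U) : Prop :=
  ∀ z ∈ φ.domain, φ.push X z = (1, 0) ∧ φ.push V z = (0, 1)

end PlaneChart

/-! ### The canonical algebra -/

/-- The field `ξ ∂x + η ∂y` on `D`, for functions `ξ, η` that are smooth on the plane. -/
def coordField (D : Opens Plane) (ξ η : Plane → ℝ) (hξ : ContDiff ℝ ∞ ξ) (hη : ContDiff ℝ ∞ η) :
    PlaneField D :=
  PlaneField.ofFun (fun z => (ξ z, η z)) (hξ.prodMk hη).contDiffOn

/-- `⟨∂x, x² ∂x + (N - 1) x y ∂y, 2 x ∂x + (N - 1) y ∂y⟩` on `D`. -/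
def canonicalLevi (N : ℕ) (D : Opens Plane) : Submodule ℝ (PlaneField D) :=
  Submodule.span ℝ
    {coordField D (fun _ => 1) (fun _ => 0) (by fun_prop) (by fun_prop),
     coordField D (fun z => z.1 ^ 2) (fun z => ((N : ℝ) - 1) * (z.1 * z.2))
      (by fun_prop) (by fun_prop),
     coordField D (fun z => 2 * z.1) (fun z => ((N : ℝ) - 1) * z.2) (by fun_prop) (by fun_prop)}

/-- `⟨∂y, x ∂y, …, x ^ (N - 1) ∂y, y ∂y⟩` on `D`. -/
def canonicalRadical (N : ℕ) (D : Opens Plane) : Submodule ℝ (PlaneField D) :=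
  Submodule.span ℝ
    (insert (coordField D (fun _ => 0) (fun z => z.2) (by fun_prop) (by fun_prop))
      (range fun i : Fin N =>
        coordField D (fun _ => 0) (fun z => z.1 ^ (i : ℕ)) (by fun_prop) (by fun_prop)))

/-! ### Prolongation, invariant hypersurfaces and point symmetries -/

/-- Coordinates `(x; y, y', …, y⁽ⁿ⁻¹⁾)`, so `JetCoords (n + 1)` is the space of `n`-jets. -/
abbrev JetCoords (n : ℕ) : Type := ℝ × (Fin n → ℝ)

/-- The first `m` of the derivative coordinates. -/
def JetCoords.trunc {m n : ℕ} (h : m ≤ n) (j : JetCoords n) : JetCoords m :=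
  (j.1, fun i => j.2 (Fin.castLE h i))

/-- The point `(x, y)` under a jet. -/
def JetCoords.base {n : ℕ} (j : JetCoords (n + 1)) : Plane := (j.1, j.2 0)

/-- The total derivative `∂F/∂x + ∑ᵢ y⁽ⁱ⁺¹⁾ ∂F/∂y⁽ⁱ⁾`. -/
def totalDeriv {n : ℕ} (F : JetCoords (n + 1) → ℝ) (j : JetCoords (n + 2)) : ℝ :=
  fderiv ℝ F (j.trunc (Nat.le_succ _)) (1, fun i => j.2 i.succ)

/-- The coefficient `η⁽ᵏ⁾` of `∂/∂y⁽ᵏ⁾` in the prolongation of `w = ξ ∂x + η ∂y`: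
`η⁽⁰⁾ = η` and `η⁽ᵏ⁺¹⁾ = D η⁽ᵏ⁾ - y⁽ᵏ⁺¹⁾ D ξ`, with `D` the total derivative. -/
def prolongCoeff (w : Plane → Plane) : (k : ℕ) → JetCoords (k + 1) → ℝ
  | 0 => fun j => (w j.base).2
  | k + 1 => fun j => totalDeriv (prolongCoeff w k) j
      - j.2 (Fin.last (k + 1)) * totalDeriv (n := k) (fun i => (w i.base).1) j

/-- The `N`-th prolongation of `w`, a vector field on the space of `N`-jets. -/
def prolong (w : Plane → Plane) (N : ℕ) (j : JetCoords (N + 1)) : JetCoords (N + 1) :=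
  ((w j.base).1, fun k => prolongCoeff w k (j.trunc k.isLt))

/-- The hypersurface `y⁽ᴺ⁾ = f(x, y, …, y⁽ᴺ⁻¹⁾)`, with `f` considered on `Ω`, is invariant under
the vector field `w`: the `N`-th prolongation of `w` annihilates `y⁽ᴺ⁾ - f` at every point of the
hypersurface. -/
def IsInvariantHypersurface (w : Plane → Plane) (N : ℕ) (Ω : Set (JetCoords N))
    (f : JetCoords N → ℝ) : Prop :=
  ∀ j : JetCoords (N + 1), j.trunc (Nat.le_succ N) ∈ Ω →
    j.2 (Fin.last N) = f (j.trunc (Nat.le_succ N)) →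
    fderiv ℝ (fun i : JetCoords (N + 1) => i.2 (Fin.last N) - f (i.trunc (Nat.le_succ N))) j
      (prolong w N j) = 0

/-- The set of all (infinitesimal) point symmetries on `D` of the equation `y⁽ᴺ⁾ = 0`. -/
def pointSymmetries (N : ℕ) (D : Opens Plane) : Set (PlaneField D) :=
  {w | ∀ j : JetCoords (N + 1), j.base ∈ D → j.2 (Fin.last N) = 0 →
    fderiv ℝ (fun i : JetCoords (N + 1) => i.2 (Fin.last N)) j (prolong w N j) = 0}

end

/-!
# The canonical form of planar algebras `sl₂ ⋉ (W ⊕ 1)` with a radical of rank one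

*Coordinates.* `X` and `V` commute and are independent at `p`, so the coframe dual to `(X, V)` is
closed near `p` (`fderiv_planeCoframe_symm`); by the Poincaré lemma it is the differential of a map
of the plane, which is a chart by the inverse function theorem (`exists_isCanonical`).

*The algebra.* Let `X = ∂x` and `V = ∂y`. The brackets of `H` with `∂x` and `∂y` say that the
derivative of `H` is constant, so `H` is linear after a translation. Since the radical has rank one
and contains `∂y`, it is vertical. Hence `[Y, ∂y]` is vertical, and this together with
`[∂x, Y] = H` and `[H, Y] = -2 Y` gives `Y = -x² ∂x + (-μ x y + h(y)) ∂y`. The one-dimensional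
summand of the radical is a trivial representation, as `sl₂` is perfect; commuting with `∂x` and `H`
makes its generator a multiple of `y ∂y`, and `Y` commutes with `y ∂y` only if `h = 0`
(`PlaneField.eq_of_relations`). The irreducible summand is spanned by the fields `(ad Y)ⁱ ∂y`, which
are nonzero multiples of `xⁱ ∂y`, and its dimension is one more than the highest weight `μ`
(`IsSl2Triple.weight_eq_and_eq_span`, `PlaneField.lowering_orbit`).

*Symmetries.* Along the graph of a function `u` the coefficient `η⁽ᴺ⁾` of the prolongation of
`ξ ∂x + η ∂y` is `dᴺ/dxᴺ (η - ξ u') + ξ u⁽ᴺ⁺¹⁾` (`PlaneField.prolongCoeff_jetOf`), and every jet with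
`y⁽ᴺ⁾ = 0` is the jet of a polynomial of degree less than `N`. So a field is a symmetry exactly when
`dᴺ/dxᴺ (η - ξ u') = 0` for all such polynomials `u` (`mem_pointSymmetries_iff`). For the canonical
algebra `η - ξ u'` is visibly a polynomial of degree less than `N`. Conversely, the derivative of
the condition in the directions `(x - x₀)ᴺ⁻¹` and `(x - x₀)ᴺ⁻²` at quadratic and at constant
solutions yields `ξ_y = 0`, `η_yy = 0`, `2 η_xy = (N - 1) ξ_xx`, `ξ_xxx = 0` and `∂ᴺη/∂xᴺ = 0`
when `N ≥ 3` (`determining_equations`); on a connected domain these integrate to the canonical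
algebra.

*Invariant hypersurfaces.* The radical alone forces `f = 0`, see
`eq_zero_of_isInvariantHypersurface`.
-/

/-! ### Partial derivatives in the plane -/

/-- The partial derivative of a function on the plane in the first coordinate. -/
noncomputable def partialX (f : Plane → ℝ) (q : Plane) : ℝ := fderiv ℝ f q (1, 0)

/-- The partial derivative of a function on the plane in the second coordinate. -/
noncomputable def partialY (f : Plane → ℝ) (q : Plane) : ℝ := fderiv ℝ f q (0, 1)

theorem clm_plane_apply {F : Type*} [NormedAddCommGroup F] [NormedSpace ℝ F] (L : Plane →L[ℝ] F)
    (v : Plane) : L v = v.1 • L (1, 0) + v.2 • L (0, 1) := by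
  rw [← map_smul, ← map_smul, ← map_add]
  simp

theorem clm_plane_ext {F : Type*} [NormedAddCommGroup F] [NormedSpace ℝ F] {L M : Plane →L[ℝ] F}
    (h₁ : L (1, 0) = M (1, 0)) (h₂ : L (0, 1) = M (0, 1)) : L = M := by
  ext <;> simp [h₁, h₂]

theorem fderiv_eq_partial (f : Plane → ℝ) (q v : Plane) :
    fderiv ℝ f q v = v.1 * partialX f q + v.2 * partialY f q := by
  rw [clm_plane_apply]; rfl

section

variable {D : Set Plane} {f g : Plane → ℝ} {q : Plane}

theorem ContDiffOn.differentiableAt_of_isOpen {F : Type*} [NormedAddCommGroup F] [NormedSpace ℝ F]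
    {f : Plane → F} (hf : ContDiffOn ℝ ∞ f D) (hD : IsOpen D) (hq : q ∈ D) :
    DifferentiableAt ℝ f q :=
  (hf.contDiffAt (hD.mem_nhds hq)).differentiableAt (by simp)

theorem ContDiffOn.partialX (hf : ContDiffOn ℝ ∞ f D) (hD : IsOpen D) :
    ContDiffOn ℝ ∞ (partialX f) D :=
  (hf.fderiv_of_isOpen hD (by simp)).clm_apply contDiffOn_const

theorem ContDiffOn.partialY (hf : ContDiffOn ℝ ∞ f D) (hD : IsOpen D) :
    ContDiffOn ℝ ∞ (partialY f) D :=
  (hf.fderiv_of_isOpen hD (by simp)).clm_apply contDiffOn_const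

theorem ContDiffOn.iterate_partialX (hf : ContDiffOn ℝ ∞ f D) (hD : IsOpen D) (n : ℕ) :
    ContDiffOn ℝ ∞ (_root_.partialX^[n] f) D := by
  induction n with
  | zero => exact hf
  | succ n ih => rw [Function.iterate_succ_apply']; exact ih.partialX hD

theorem partialX_congr (hD : IsOpen D) (h : EqOn f g D) : EqOn (partialX f) (partialX g) D := by
  intro q hq
  rw [partialX, partialX, (h.eventuallyEq_of_mem (hD.mem_nhds hq)).fderiv_eq]

theorem partialY_congr (hD : IsOpen D) (h : EqOn f g D) : EqOn (partialY f) (partialY g) D := by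
  intro q hq
  rw [partialY, partialY, (h.eventuallyEq_of_mem (hD.mem_nhds hq)).fderiv_eq]

theorem partialX_const (c : ℝ) : partialX (fun _ => c) = fun _ => 0 := by
  funext q; simp [partialX]

theorem partialY_const (c : ℝ) : partialY (fun _ => c) = fun _ => 0 := by
  funext q; simp [partialY]

theorem partialX_partialY_comm (hf : ContDiffOn ℝ ∞ f D) (hD : IsOpen D) (hq : q ∈ D) :
    partialX (partialY f) q = partialY (partialX f) q := by
  have h1 : DifferentiableAt ℝ (fderiv ℝ f) q :=
    (hf.fderiv_of_isOpen hD (m := ∞) (by simp)).differentiableAt_of_isOpen hD hq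
  have hs : IsSymmSndFDerivAt ℝ f q :=
    (hf.contDiffAt (hD.mem_nhds hq)).isSymmSndFDerivAt
      (by rw [minSmoothness_of_isRCLikeNormedField]; exact ENat.LEInfty.out)
  change fderiv ℝ (fun z => fderiv ℝ f z (0, 1)) q (1, 0)
    = fderiv ℝ (fun z => fderiv ℝ f z (1, 0)) q (0, 1)
  rw [fderiv_clm_apply h1 (by fun_prop), fderiv_clm_apply h1 (by fun_prop)]
  simpa using hs.eq (1, 0) (0, 1)

theorem iterate_partialX_partialY_comm (hf : ContDiffOn ℝ ∞ f D) (hD : IsOpen D) (n : ℕ) :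
    EqOn (partialX^[n] (partialY f)) (partialY (partialX^[n] f)) D := by
  induction n with
  | zero => exact fun _ _ => rfl
  | succ n ih =>
    rw [Function.iterate_succ_apply', Function.iterate_succ_apply']
    exact (partialX_congr hD ih).trans
      fun q hq => partialX_partialY_comm (hf.iterate_partialX hD n) hD hq

theorem partialX_sub (hf : DifferentiableAt ℝ f q) (hg : DifferentiableAt ℝ g q) :
    partialX (fun z => f z - g z) q = partialX f q - partialX g q := by
  simp [partialX, fderiv_fun_sub hf hg]

theorem partialY_sub (hf : DifferentiableAt ℝ f q) (hg : DifferentiableAt ℝ g q) :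
    partialY (fun z => f z - g z) q = partialY f q - partialY g q := by
  simp [partialY, fderiv_fun_sub hf hg]

theorem partialX_const_mul (hf : DifferentiableAt ℝ f q) (c : ℝ) :
    partialX (fun z => c * f z) q = c * partialX f q := by
  simp [partialX, fderiv_const_mul hf]

theorem hasFDerivAt_comp_fst {h : ℝ → ℝ} {h' : ℝ} (hh : HasDerivAt h h' q.1) :
    HasFDerivAt (fun z : Plane => h z.1)
      (h' • ContinuousLinearMap.fst ℝ ℝ ℝ) q :=
  hh.comp_hasFDerivAt q hasFDerivAt_fst

theorem hasFDerivAt_comp_fst_mul_snd {h : ℝ → ℝ} {h' : ℝ} (hh : HasDerivAt h h' q.1) :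
    HasFDerivAt (fun z : Plane => h z.1 * z.2)
      (h q.1 • ContinuousLinearMap.snd ℝ ℝ ℝ + q.2 • h' • ContinuousLinearMap.fst ℝ ℝ ℝ) q :=
  (hasFDerivAt_comp_fst hh).mul hasFDerivAt_snd

theorem partialX_comp_fst {h : ℝ → ℝ} {h' : ℝ} (hh : HasDerivAt h h' q.1) :
    partialX (fun z => h z.1) q = h' := by
  simp [partialX, (hasFDerivAt_comp_fst hh).fderiv]

theorem partialY_comp_fst {h : ℝ → ℝ} {h' : ℝ} (hh : HasDerivAt h h' q.1) :
    partialY (fun z => h z.1) q = 0 := by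
  simp [partialY, (hasFDerivAt_comp_fst hh).fderiv]

theorem partialY_mul_snd {h : ℝ → ℝ} {h' : ℝ} (hh : HasDerivAt h h' q.1) :
    partialY (fun z => h z.1 * z.2) q = h q.1 := by
  rw [partialY, (hasFDerivAt_comp_fst_mul_snd hh).fderiv]
  simp

/-- On a connected open set a function with vanishing partial derivatives is constant. -/
theorem exists_const_of_partial_eq_zero (hf : ContDiffOn ℝ ∞ f D) (hD : IsOpen D)
    (hD' : IsPreconnected D) (hx : ∀ q ∈ D, partialX f q = 0) (hy : ∀ q ∈ D, partialY f q = 0) :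
    ∃ c, ∀ q ∈ D, f q = c := by
  refine hD.exists_is_const_of_fderiv_eq_zero hD'
    (fun q hq => (hf.differentiableAt_of_isOpen hD hq).differentiableWithinAt) fun q hq => ?_
  exact ContinuousLinearMap.ext fun v => by simp [fderiv_eq_partial, hx q hq, hy q hq]

/-- On a connected open set `∂f/∂y = 0` and `∂ⁿf/∂xⁿ = 0` force `f` to be a polynomial in `x` of
degree less than `n`. -/
theorem exists_polynomial_of_partial_eq_zero (hD : IsOpen D) (hD' : IsPreconnected D) (n : ℕ) :
    ∀ f : Plane → ℝ, ContDiffOn ℝ ∞ f D → (∀ q ∈ D, partialY f q = 0) →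
      (∀ q ∈ D, partialX^[n] f q = 0) →
      ∃ c : ℕ → ℝ, ∀ q ∈ D, f q = ∑ i ∈ Finset.range n, c i * q.1 ^ i := by
  induction n with
  | zero => exact fun f _ _ h => ⟨0, fun q hq => by simpa using h q hq⟩
  | succ n ih =>
    intro f hf hy hx
    obtain ⟨c, hc⟩ := ih (partialX f) (hf.partialX hD)
      (fun q hq => by
        rw [← partialX_partialY_comm hf hD hq, partialX_congr hD hy hq, partialX_const])
      (fun q hq => by rw [← Function.iterate_succ_apply]; exact hx q hq)
    have hP (x : ℝ) : HasDerivAt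
        (fun x : ℝ => ∑ i ∈ Finset.range n, c i / (i + 1) * x ^ (i + 1))
        (∑ i ∈ Finset.range n, c i * x ^ i) x := by
      refine HasDerivAt.fun_sum fun i _ => ?_
      refine ((hasDerivAt_pow (i + 1) x).const_mul (c i / (i + 1))).congr_deriv ?_
      have : (i : ℝ) + 1 ≠ 0 := by positivity
      push_cast
      field_simp
    have hPs : ContDiff ℝ ∞
        (fun z : Plane => ∑ i ∈ Finset.range n, c i / (i + 1) * z.1 ^ (i + 1)) := by fun_prop
    obtain ⟨a, ha⟩ := exists_const_of_partial_eq_zero (hf.sub hPs.contDiffOn) hD hD'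
      (fun q hq => by
        change partialX (fun z => f z - _) q = 0
        rw [partialX_sub (hf.differentiableAt_of_isOpen hD hq)
          (hPs.differentiable (by simp) q), partialX_comp_fst (hP q.1), hc q hq, sub_self])
      (fun q hq => by
        change partialY (fun z => f z - _) q = 0
        rw [partialY_sub (hf.differentiableAt_of_isOpen hD hq)
          (hPs.differentiable (by simp) q), partialY_comp_fst (hP q.1), hy q hq, sub_self])
    refine ⟨fun i => if i = 0 then a else c (i - 1) / i, fun q hq => ?_⟩
    rw [Finset.sum_range_succ']
    have h' : f q - ∑ i ∈ Finset.range n, c i / (i + 1) * q.1 ^ (i + 1) = a := ha q hq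
    simp only [Nat.add_eq_zero_iff, one_ne_zero, and_false, if_false, if_true, pow_zero, mul_one,
      add_tsub_cancel_right, Nat.cast_add, Nat.cast_one]
    linarith

/-- A continuous function on an open set vanishes if its product with `y` does. -/
theorem eq_zero_of_snd_mul_eq_zero (hf : ContinuousOn f D) (hD : IsOpen D)
    (h : ∀ q ∈ D, q.2 * f q = 0) : ∀ q ∈ D, f q = 0 := by
  intro q hq
  by_contra hne
  have h1 : ∀ᶠ z in 𝓝 q, f z ≠ 0 ∧ z ∈ D :=
    ((hf.continuousAt (hD.mem_nhds hq)).eventually_ne hne).and (hD.mem_nhds hq)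
  have h2 : Tendsto (fun t : ℝ => ((q.1, t) : Plane)) (𝓝[≠] q.2) (𝓝 q) :=
    ((Continuous.prodMk_right q.1).tendsto' _ _ rfl).mono_left nhdsWithin_le_nhds
  have h3 : Tendsto (fun t : ℝ => ((q.1, t) : Plane)) (𝓝 q.2) (𝓝 q) :=
    (Continuous.prodMk_right q.1).tendsto' _ _ rfl
  by_cases h0 : q.2 = 0
  · obtain ⟨t, ⟨ht1, ht2⟩, ht3⟩ := ((h2.eventually h1).and self_mem_nhdsWithin).exists
    rcases mul_eq_zero.1 (h _ ht2) with h4 | h4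
    · exact ht3 (by simpa [h0] using h4)
    · exact ht1 h4
  · exact (mul_ne_zero h0 hne) (h q hq)

/-- The chain rule along the graph of `u`. -/
theorem hasDerivAt_along_graph {u : ℝ → ℝ} {u' x : ℝ} (hu : HasDerivAt u u' x)
    (hf : DifferentiableAt ℝ f (x, u x)) :
    HasDerivAt (fun x => f (x, u x)) (partialX f (x, u x) + u' * partialY f (x, u x)) x := by
  have h := hf.hasFDerivAt.comp_hasDerivAt x ((hasDerivAt_id x).prodMk hu)
  rw [fderiv_eq_partial, one_mul] at h
  exact h

theorem ContDiffOn.along_graph {u : ℝ → ℝ} (hf : ContDiffOn ℝ ∞ f D) (hD : IsOpen D)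
    (hu : ContDiff ℝ ∞ u) {x : ℝ} (hx : (x, u x) ∈ D) :
    ContDiffAt ℝ ∞ (fun x => f (x, u x)) x :=
  (hf.contDiffAt (hD.mem_nhds hx)).comp x (contDiff_id.prodMk hu).contDiffAt

theorem eventually_graph_mem (hD : IsOpen D) {u : ℝ → ℝ} (hu : Continuous u) {x : ℝ}
    (hx : (x, u x) ∈ D) : ∀ᶠ t in 𝓝 x, (t, u t) ∈ D :=
  (continuous_id.prodMk hu).continuousAt.eventually (hD.mem_nhds hx)

end

/-! ### Canonical coordinates for two commuting fields -/

/-- The linear map of the plane with columns `a` and `b`. -/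
noncomputable def planeFrame (a b : Plane) : Plane →L[ℝ] Plane :=
  (ContinuousLinearMap.fst ℝ ℝ ℝ).smulRight a + (ContinuousLinearMap.snd ℝ ℝ ℝ).smulRight b

theorem planeFrame_apply (a b v : Plane) : planeFrame a b v = v.1 • a + v.2 • b := rfl

/-- The determinant of the linear map with columns `a` and `b`. -/
def planeDet (a b : Plane) : ℝ := a.1 * b.2 - a.2 * b.1

/-- The inverse of the linear map with columns `a` and `b` (junk if `a`, `b` are dependent). -/
noncomputable def planeCoframe (a b : Plane) : Plane →L[ℝ] Plane :=
  (planeDet a b)⁻¹ • planeFrame (b.2, -a.2) (-b.1, a.1)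

theorem planeCoframe_left {a b : Plane} (h : planeDet a b ≠ 0) : planeCoframe a b a = (1, 0) := by
  simp only [planeCoframe, _root_.smul_apply, planeFrame_apply]
  ext
  · simp only [planeDet, Prod.smul_fst, Prod.fst_add, smul_eq_mul] at h ⊢
    field_simp
    ring
  · simp only [Prod.smul_snd, Prod.snd_add, smul_eq_mul]
    ring

theorem planeCoframe_right {a b : Plane} (h : planeDet a b ≠ 0) : planeCoframe a b b = (0, 1) := by
  simp only [planeCoframe, _root_.smul_apply, planeFrame_apply]
  ext
  · simp only [Prod.smul_fst, Prod.fst_add, smul_eq_mul]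
    ring
  · simp only [planeDet, Prod.smul_snd, Prod.snd_add, smul_eq_mul] at h ⊢
    field_simp
    ring

/-- The coframe as a linear automorphism of the plane. -/
noncomputable def planeCoframeEquiv {a b : Plane} (h : planeDet a b ≠ 0) : Plane ≃L[ℝ] Plane :=
  ContinuousLinearEquiv.equivOfInverse (planeCoframe a b) (planeFrame a b)
    (fun v => by
      have key : (planeFrame a b).comp (planeCoframe a b) = ContinuousLinearMap.id ℝ Plane := by
        refine clm_plane_ext ?_ ?_ <;>
        simp only [planeCoframe, ContinuousLinearMap.comp_apply, _root_.smul_apply,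
            planeFrame_apply, ContinuousLinearMap.id_apply] <;>
        · ext <;> simp [planeDet] at h ⊢ <;> field_simp <;> ring
      exact congrArg (fun L : Plane →L[ℝ] Plane => L v) key)
    (fun v => by
      rw [planeFrame_apply, map_add, map_smul, map_smul, planeCoframe_left h, planeCoframe_right h]
      simp)

theorem planeDet_ne_zero_of_linearIndependent {a b : Plane}
    (h : LinearIndependent ℝ ![a, b]) : planeDet a b ≠ 0 := by
  intro h0
  rw [LinearIndependent.pair_iff] at h
  simp only [planeDet] at h0
  have h1 := h b.2 (-a.2) (by ext <;> simp <;> linarith)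
  have h2 := h b.1 (-a.1) (by ext <;> simp <;> linarith)
  have ha : a = 0 := by ext <;> simp <;> linarith [h1.2, h2.2]
  have := h 1 0 (by simp [ha])
  simp at this

theorem ContDiffOn.planeCoframe {D : Set Plane} {v w : Plane → Plane} (hv : ContDiffOn ℝ ∞ v D)
    (hw : ContDiffOn ℝ ∞ w D) (h : ∀ q ∈ D, planeDet (v q) (w q) ≠ 0) :
    ContDiffOn ℝ ∞ (fun q => planeCoframe (v q) (w q)) D := by
  have hF {a b : Plane → Plane} (ha : ContDiffOn ℝ ∞ a D) (hb : ContDiffOn ℝ ∞ b D) :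
      ContDiffOn ℝ ∞ (fun q => planeFrame (a q) (b q)) D := by
    unfold planeFrame
    exact (contDiffOn_const.smulRight ha).add (contDiffOn_const.smulRight hb)
  unfold _root_.planeCoframe
  refine ContDiffOn.smul (ContDiffOn.inv ?_ h) (hF ?_ ?_)
  · unfold planeDet; fun_prop
  · fun_prop
  · fun_prop

/-- The dual coframe of a commuting frame is closed. -/
theorem fderiv_planeCoframe_symm {D : Set Plane} (hD : IsOpen D) {v w : Plane → Plane}
    (hv : ContDiffOn ℝ ∞ v D) (hw : ContDiffOn ℝ ∞ w D)
    (h : ∀ q ∈ D, planeDet (v q) (w q) ≠ 0) (hvw : ∀ q ∈ D, lieBracket ℝ v w q = 0)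
    {q : Plane} (hq : q ∈ D) (a b : Plane) :
    fderiv ℝ (fun q => planeCoframe (v q) (w q)) q a b
      = fderiv ℝ (fun q => planeCoframe (v q) (w q)) q b a := by
  set θ : Plane → Plane →L[ℝ] Plane := fun q => planeCoframe (v q) (w q) with hθ
  have hθd : DifferentiableAt ℝ θ q := (hv.planeCoframe hw h).differentiableAt_of_isOpen hD hq
  have hvd := hv.differentiableAt_of_isOpen hD hq
  have hwd := hw.differentiableAt_of_isOpen hD hq
  -- differentiating the constant functions `θ v` and `θ w`
  have e1 (c : Plane) : fderiv ℝ θ q c (v q) + θ q (fderiv ℝ v q c) = 0 := by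
    have : fderiv ℝ (fun z => θ z (v z)) q = 0 := by
      rw [((show EqOn (fun z => θ z (v z)) (fun _ => (1, 0)) D from
        fun z hz => planeCoframe_left (h z hz)).eventuallyEq_of_mem (hD.mem_nhds hq)).fderiv_eq]
      simp
    rw [fderiv_clm_apply hθd hvd] at this
    have := congrArg (fun L : Plane →L[ℝ] Plane => L c) this
    simpa [add_comm] using this
  have e2 (c : Plane) : fderiv ℝ θ q c (w q) + θ q (fderiv ℝ w q c) = 0 := by
    have : fderiv ℝ (fun z => θ z (w z)) q = 0 := by
      rw [((show EqOn (fun z => θ z (w z)) (fun _ => (0, 1)) D from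
        fun z hz => planeCoframe_right (h z hz)).eventuallyEq_of_mem (hD.mem_nhds hq)).fderiv_eq]
      simp
    rw [fderiv_clm_apply hθd hwd] at this
    have := congrArg (fun L : Plane →L[ℝ] Plane => L c) this
    simpa [add_comm] using this
  have hb : fderiv ℝ w q (v q) = fderiv ℝ v q (w q) := sub_eq_zero.1 (hvw q hq)
  have key : fderiv ℝ θ q (v q) (w q) = fderiv ℝ θ q (w q) (v q) := by
    rw [eq_neg_of_add_eq_zero_left (e2 (v q)), eq_neg_of_add_eq_zero_left (e1 (w q)), hb]
  -- symmetry on the frame gives symmetry on all vectors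
  have hsp (c : Plane) : c = (θ q c).1 • v q + (θ q c).2 • w q :=
    ((planeCoframeEquiv (h q hq)).symm_apply_apply c).symm
  rw [hsp a, hsp b]
  simp only [map_add, map_smul, _root_.add_apply, _root_.smul_apply, key]
  simp only [smul_add, smul_smul, mul_comm]
  abel

theorem PlaneChart.push_apply {U : Opens Plane} (φ : PlaneChart U) (v : PlaneField U) {z : Plane}
    (hz : z ∈ φ.domain) :
    φ.push v z = fderiv ℝ φ.toHomeo (φ.toHomeo.symm z) (v (φ.toHomeo.symm z)) :=
  PlaneField.ofFun_apply _ (φ.contDiffOn_pushforward v) hz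

/-- Two commuting fields that are independent at `p` are `∂x` and `∂y` in suitable coordinates
near `p`: the dual coframe is closed, hence the differential of a map of the plane, which is
a local diffeomorphism. -/
theorem exists_isCanonical {U : Opens Plane} (X V : PlaneField U) {p : Plane} (hp : p ∈ U)
    (hind : LinearIndependent ℝ ![X.1 p, V.1 p]) (hXV : ⁅X, V⁆ = 0) :
    ∃ φ : PlaneChart U, IsConnected φ.toHomeo.source ∧ p ∈ φ.toHomeo.source ∧
      φ.IsCanonical X V := by
  have hdet : ContinuousOn (fun q => planeDet (X q) (V q)) U := by
    have h1 : ContinuousOn X U := X.2.1.continuousOn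
    have h2 : ContinuousOn V U := V.2.1.continuousOn
    unfold planeDet
    fun_prop
  have hnear : ∀ᶠ q in 𝓝 p, planeDet (X q) (V q) ≠ 0 ∧ q ∈ U :=
    ((hdet.continuousAt (U.isOpen.mem_nhds hp)).eventually_ne
      (planeDet_ne_zero_of_linearIndependent hind)).and (U.isOpen.mem_nhds hp)
  obtain ⟨r, hr, hball⟩ := Metric.eventually_nhds_iff_ball.1 hnear
  have hX : ContDiffOn ℝ ∞ X (Metric.ball p r) := X.2.1.mono fun q hq => (hball q hq).2
  have hV : ContDiffOn ℝ ∞ V (Metric.ball p r) := V.2.1.mono fun q hq => (hball q hq).2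
  have hd : ∀ q ∈ Metric.ball p r, planeDet (X q) (V q) ≠ 0 := fun q hq => (hball q hq).1
  have hθ := hX.planeCoframe hV hd
  obtain ⟨f, hf⟩ := (convex_ball p r).exists_forall_hasFDerivAt_of_fderiv_symmetric
    Metric.isOpen_ball (hθ.differentiableOn (by simp))
    (fun q hq a b => fderiv_planeCoframe_symm Metric.isOpen_ball hX hV hd
      (fun z hz => by rw [← PlaneField.bracket_apply X V (hball z hz).2, hXV]; rfl) hq a b)
  have hfs : ContDiffOn ℝ ∞ f (Metric.ball p r) :=
    (contDiffOn_infty_iff_fderiv_of_isOpen Metric.isOpen_ball).2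
      ⟨fun q hq => (hf q hq).differentiableAt.differentiableWithinAt,
        hθ.congr fun q hq => (hf q hq).fderiv⟩
  have hpb : p ∈ Metric.ball p r := Metric.mem_ball_self hr
  have hfe (q) (hq : q ∈ Metric.ball p r) :
      HasFDerivAt f (planeCoframeEquiv (hd q hq) : Plane →L[ℝ] Plane) q := hf q hq
  set e := (hfs.contDiffAt (Metric.isOpen_ball.mem_nhds hpb)).toOpenPartialHomeomorph f
    (hfe p hpb) (by simp)
  have hpe : p ∈ e.source := ContDiffAt.mem_toOpenPartialHomeomorph_source _ _ _
  obtain ⟨r', hr', hball'⟩ := Metric.isOpen_iff.1 (e.open_source.inter Metric.isOpen_ball)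
    p ⟨hpe, hpb⟩
  have hsrc : (e.restrOpen (Metric.ball p r') Metric.isOpen_ball).source = Metric.ball p r' := by
    rw [OpenPartialHomeomorph.restrOpen_source]
    exact inter_eq_right.2 fun q hq => (hball' hq).1
  have hsub : ∀ q ∈ (e.restrOpen (Metric.ball p r') Metric.isOpen_ball).source,
      q ∈ Metric.ball p r := fun q hq => (hball' (hsrc ▸ hq)).2
  refine ⟨⟨e.restrOpen (Metric.ball p r') Metric.isOpen_ball, fun q hq => (hball q (hsub q hq)).2,
    hfs.mono hsub, fun z hz => ?_⟩, ?_, ?_, ?_⟩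
  · have hq := hsub _ (OpenPartialHomeomorph.map_target _ hz)
    exact (OpenPartialHomeomorph.contDiffAt_symm _ hz (hfe _ hq)
      (hfs.contDiffAt (Metric.isOpen_ball.mem_nhds hq))).contDiffWithinAt
  · change IsConnected (e.restrOpen (Metric.ball p r') Metric.isOpen_ball).source
    rw [hsrc]
    exact ((convex_ball p r').isPathConnected ⟨p, Metric.mem_ball_self hr'⟩).isConnected
  · change p ∈ (e.restrOpen (Metric.ball p r') Metric.isOpen_ball).source
    rw [hsrc]
    exact Metric.mem_ball_self hr'
  · intro z hz
    have hq := hsub _ (OpenPartialHomeomorph.map_target _ hz)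
    constructor
    · rw [PlaneChart.push_apply _ _ hz]
      change fderiv ℝ f _ _ = _
      rw [(hf _ hq).fderiv]
      exact planeCoframe_left (hd _ hq)
    · rw [PlaneChart.push_apply _ _ hz]
      change fderiv ℝ f _ _ = _
      rw [(hf _ hq).fderiv]
      exact planeCoframe_right (hd _ hq)

/-! ### Fields in a chart -/

namespace PlaneChart

variable {U : Opens Plane} (φ : PlaneChart U)

theorem symm_mem {z : Plane} (hz : z ∈ φ.domain) : φ.toHomeo.symm z ∈ φ.toHomeo.source :=
  φ.toHomeo.map_target hz

theorem apply_mem {q : Plane} (hq : q ∈ φ.toHomeo.source) : φ.toHomeo q ∈ φ.domain :=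
  φ.toHomeo.map_source hq

theorem contDiffAt_symm {z : Plane} (hz : z ∈ φ.domain) : ContDiffAt ℝ ∞ φ.toHomeo.symm z :=
  φ.contDiffOn_symm.contDiffAt (φ.toHomeo.open_target.mem_nhds hz)

theorem contDiffAt_toHomeo {q : Plane} (hq : q ∈ φ.toHomeo.source) : ContDiffAt ℝ ∞ φ.toHomeo q :=
  φ.contDiffOn_toFun.contDiffAt (φ.toHomeo.open_source.mem_nhds hq)

theorem fderiv_comp_fderiv_symm {z : Plane} (hz : z ∈ φ.domain) :
    (fderiv ℝ φ.toHomeo (φ.toHomeo.symm z)).comp (fderiv ℝ φ.toHomeo.symm z)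
      = ContinuousLinearMap.id ℝ Plane := by
  rw [← fderiv_comp z ((φ.contDiffAt_toHomeo (φ.symm_mem hz)).differentiableAt (by simp))
    ((φ.contDiffAt_symm hz).differentiableAt (by simp))]
  have : (φ.toHomeo ∘ φ.toHomeo.symm) =ᶠ[𝓝 z] id := by
    filter_upwards [φ.toHomeo.open_target.mem_nhds hz] with w hw
    exact φ.toHomeo.right_inv hw
  rw [this.fderiv_eq, fderiv_id]

theorem fderiv_symm_comp_fderiv {q : Plane} (hq : q ∈ φ.toHomeo.source) :
    (fderiv ℝ φ.toHomeo.symm (φ.toHomeo q)).comp (fderiv ℝ φ.toHomeo q)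
      = ContinuousLinearMap.id ℝ Plane := by
  rw [← fderiv_comp q ((φ.contDiffAt_symm (φ.apply_mem hq)).differentiableAt (by simp))
    ((φ.contDiffAt_toHomeo hq).differentiableAt (by simp))]
  have : (φ.toHomeo.symm ∘ φ.toHomeo) =ᶠ[𝓝 q] id := by
    filter_upwards [φ.toHomeo.open_source.mem_nhds hq] with w hw
    exact φ.toHomeo.left_inv hw
  rw [this.fderiv_eq, fderiv_id]

theorem push_eq_pullback (v : PlaneField U) {z : Plane} (hz : z ∈ φ.domain) :
    φ.push v z = pullback ℝ φ.toHomeo.symm v z := by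
  have h := φ.fderiv_symm_comp_fderiv (φ.symm_mem hz)
  rw [φ.toHomeo.right_inv hz] at h
  rw [φ.push_apply v hz, pullback,
    ContinuousLinearMap.inverse_eq (g := fderiv ℝ φ.toHomeo (φ.toHomeo.symm z)) h
      (φ.fderiv_comp_fderiv_symm hz)]

theorem push_lie (v w : PlaneField U) : φ.push ⁅v, w⁆ = ⁅φ.push v, φ.push w⁆ := by
  refine PlaneField.ext_on fun z hz => ?_
  have hU : φ.toHomeo.symm z ∈ U := φ.source_subset (φ.symm_mem hz)
  have hev (u : PlaneField U) :
      (φ.push u : Plane → Plane) =ᶠ[𝓝 z] pullback ℝ φ.toHomeo.symm u := by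
    filter_upwards [φ.toHomeo.open_target.mem_nhds hz] with y hy
    exact φ.push_eq_pullback u hy
  rw [PlaneField.bracket_apply _ _ hz, (hev v).lieBracket_vectorField_eq (hev w),
    φ.push_eq_pullback _ hz, ← pullback_lieBracket (n := ∞)
      (by rw [minSmoothness_of_isRCLikeNormedField]; exact ENat.LEInfty.out)
      (φ.contDiffAt_symm hz) (PlaneField.differentiableAt v hU) (PlaneField.differentiableAt w hU),
    pullback, pullback, PlaneField.bracket_apply _ _ hU]

theorem translate_domain (c : Plane) {z : Plane} :
    z ∈ (φ.translate c).domain ↔ z - c ∈ φ.domain := by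
  rw [sub_eq_add_neg]; rfl

theorem push_translate (c : Plane) (v : PlaneField U) {z : Plane}
    (hz : z ∈ (φ.translate c).domain) : (φ.translate c).push v z = φ.push v (z - c) := by
  have hs : (φ.translate c).toHomeo.symm z = φ.toHomeo.symm (z - c) := by
    rw [sub_eq_add_neg]; rfl
  rw [push_apply _ _ hz, push_apply _ _ ((φ.translate_domain c).1 hz), hs]
  change fderiv ℝ (fun q => φ.toHomeo q + c) _ _ = _
  rw [fderiv_add_const]

theorem isCanonical_translate {X V : PlaneField U} (h : φ.IsCanonical X V) (c : Plane) :
    (φ.translate c).IsCanonical X V := fun z hz => by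
  rw [push_translate _ _ _ hz, push_translate _ _ _ hz]
  exact h _ ((φ.translate_domain c).1 hz)

theorem isPreconnected_domain (h : IsConnected φ.toHomeo.source) :
    IsPreconnected (φ.domain : Set Plane) := by
  have := h.isPreconnected.image φ.toHomeo φ.contDiffOn_toFun.continuousOn
  rwa [φ.toHomeo.image_source_eq_target] at this

/-- A field whose expression in a chart vanishes is zero near every point of the chart. -/
theorem eventuallyEq_zero_of_push_eq_zero {v : PlaneField U} (h : φ.push v = 0) {q : Plane}
    (hq : q ∈ φ.toHomeo.source) : (v : Plane → Plane) =ᶠ[𝓝 q] 0 := by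
  filter_upwards [φ.toHomeo.open_source.mem_nhds hq] with w hw
  have h1 : φ.push v (φ.toHomeo w) = 0 := by rw [h]; rfl
  rw [φ.push_apply v (φ.apply_mem hw), φ.toHomeo.left_inv hw] at h1
  have h2 := congrArg (fun L : Plane →L[ℝ] Plane => L (v w)) (φ.fderiv_symm_comp_fderiv hw)
  simp only [ContinuousLinearMap.comp_apply, h1, map_zero, ContinuousLinearMap.id_apply] at h2
  exact h2.symm

end PlaneChart

namespace PlaneField

theorem bracket_apply_fderiv {D : Opens Plane} (v w : PlaneField D) {q : Plane} (hq : q ∈ D) :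
    (⁅v, w⁆ : PlaneField D) q = fderiv ℝ w q (v q) - fderiv ℝ v q (w q) :=
  bracket_apply v w hq

theorem exists_eq_smul_of_finrank_le_one {K : Submodule ℝ Plane} (hK : Module.finrank ℝ K ≤ 1)
    {a b : Plane} (ha : a ∈ K) (hb : b ∈ K) (hne : a ≠ 0) : ∃ c : ℝ, b = c • a := by
  obtain ⟨⟨e, he⟩, hspan⟩ := finrank_le_one_iff.1 hK
  obtain ⟨c, hc⟩ := hspan ⟨a, ha⟩
  obtain ⟨d, hd⟩ := hspan ⟨b, hb⟩
  have hc' : c • e = a := congrArg Subtype.val hc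
  have hd' : d • e = b := congrArg Subtype.val hd
  have hc0 : c ≠ 0 := by
    rintro rfl
    exact hne (by rw [← hc', zero_smul])
  exact ⟨d / c, by rw [← hc', ← hd', smul_smul, div_mul_cancel₀ _ hc0]⟩

/-- Fields in a space of rank at most one are pointwise multiples of any nonvanishing member. -/
theorem exists_eq_smul_of_rank_le_one {U : Opens Plane} {L : Submodule ℝ (PlaneField U)}
    (hL : rank L ≤ 1) {v w : PlaneField U} (hv : v ∈ L) (hw : w ∈ L) {q : Plane} (hq : q ∈ U)
    (hne : v q ≠ 0) : ∃ c : ℝ, w q = c • v q := by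
  have hbdd : BddAbove (range fun q : U => Module.finrank ℝ (L.map (evalAt U q))) :=
    ⟨2, by
      rintro _ ⟨z, rfl⟩
      exact (Submodule.finrank_le _).trans (by simp)⟩
  have h1 : Module.finrank ℝ (L.map (evalAt U q)) ≤ 1 :=
    (le_ciSup hbdd (⟨q, hq⟩ : U)).trans hL
  exact exists_eq_smul_of_finrank_le_one h1 ⟨v, hv, rfl⟩ ⟨w, hw, rfl⟩ hne

end PlaneField

/-! ### Representations of `sl₂` -/

namespace IsSl2Triple

variable {L M : Type*} [LieRing L] [LieAlgebra ℝ L] [AddCommGroup M] [Module ℝ M]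
  [LieRingModule L M] [LieModule ℝ L M] {h e f : L}

/-- One-dimensional representations of `sl₂` are trivial, since `sl₂` is perfect. -/
theorem lie_eq_zero_of_lie_eq_smul (t : IsSl2Triple h e f) {z : M} {a b : ℝ}
    (he : ⁅e, z⁆ = a • z) (hf : ⁅f, z⁆ = b • z) : ⁅h, z⁆ = 0 ∧ ⁅e, z⁆ = 0 ∧ ⁅f, z⁆ = 0 := by
  have hh : ⁅h, z⁆ = 0 := by
    rw [← t.lie_e_f, lie_lie, hf, lie_smul, he, lie_smul, hf, smul_smul, smul_smul, mul_comm,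
      sub_self]
  refine ⟨hh, ?_, ?_⟩
  · have h2 : (2 : ℝ) • ⁅e, z⁆ = 0 := by
      rw [← smul_lie, ← t.lie_h_e_smul ℝ, lie_lie, hh, he, lie_smul, hh]
      simp
    simpa using h2
  · have h2 : -((2 : ℝ) • ⁅f, z⁆) = 0 := by
      rw [← smul_lie, ← neg_lie, ← t.lie_lie_smul_f ℝ, lie_lie, hh, hf, lie_smul, hh]
      simp
    simpa using h2

variable {X Y H V : L} {S : LieSubalgebra ℝ L} {W : LieSubmodule ℝ S L} {μ : ℝ}

/-- The span of the lowering orbit of a primitive vector `V` of weight `n`, as a subrepresentation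
of the subalgebra spanned by the triple. -/
noncomputable def loweringSpan [IsNoetherian ℝ L] (t : IsSl2Triple H X Y)
    (hS : S.toSubmodule = Submodule.span ℝ {X, Y, H}) (P : t.HasPrimitiveVectorWith V μ) {n : ℕ}
    (hn : μ = n) : LieSubmodule ℝ S L where
  toSubmodule := Submodule.span ℝ
    (range fun i : Fin (n + 1) => (LieModule.toEnd ℝ L L Y ^ (i : ℕ)) V)
  lie_mem {s m} hm := by
    set ψ : ℕ → L := fun i => (LieModule.toEnd ℝ L L Y ^ i) V with hψ
    set K := Submodule.span ℝ (range fun i : Fin (n + 1) => ψ i) with hK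
    have hmem (i : ℕ) (hi : i ≤ n) : ψ i ∈ K :=
      Submodule.subset_span ⟨⟨i, Nat.lt_succ_of_le hi⟩, rfl⟩
    have hs : (s : L) ∈ Submodule.span ℝ {X, Y, H} := hS ▸ s.2
    change ⁅(s : L), m⁆ ∈ K
    change m ∈ K at hm
    obtain ⟨s, hs'⟩ := s
    change s ∈ Submodule.span ℝ {X, Y, H} at hs
    change ⁅s, m⁆ ∈ K
    clear hs'
    induction hm using Submodule.span_induction with
    | zero => rw [lie_zero]; exact K.zero_mem
    | add u v _ _ hu hv => rw [lie_add]; exact K.add_mem hu hv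
    | smul c u _ hu => rw [lie_smul]; exact K.smul_mem c hu
    | mem u hu =>
      obtain ⟨⟨i, hi⟩, rfl⟩ := hu
      have hi' : i ≤ n := Nat.le_of_lt_succ hi
      change ⁅s, ψ i⁆ ∈ K
      induction hs using Submodule.span_induction with
      | zero => rw [zero_lie]; exact K.zero_mem
      | add u v _ _ hu hv => rw [add_lie]; exact K.add_mem hu hv
      | smul c u _ hu => rw [smul_lie]; exact K.smul_mem c hu
      | mem u hu =>
        rcases hu with rfl | rfl | rfl
        · cases i with
          | zero => simp [hψ, P.lie_e]
          | succ i =>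
            rw [P.lie_e_pow_succ_toEnd_f i]
            exact K.smul_mem _ (hmem i (by omega))
        · rw [P.lie_f_pow_toEnd_f i]
          rcases hi'.lt_or_eq with h | rfl
          · exact hmem (i + 1) h
          · rw [P.pow_toEnd_f_eq_zero_of_eq_nat hn]; exact K.zero_mem
        · rw [P.lie_h_pow_toEnd_f i]
          exact K.smul_mem _ (hmem i hi')

/-- An irreducible representation of `sl₂` with primitive vector `V` has highest weight one less
than its dimension, and is spanned by the lowering orbit of `V`. -/
theorem weight_eq_and_eq_span [IsNoetherian ℝ L] (t : IsSl2Triple H X Y)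
    (hS : S.toSubmodule = Submodule.span ℝ {X, Y, H}) (P : t.HasPrimitiveVectorWith V μ)
    (hW : LieModule.IsIrreducible ℝ S W) (hV : V ∈ W) :
    μ = (Module.finrank ℝ W : ℝ) - 1 ∧ W.toSubmodule = Submodule.span ℝ
      (range fun i : Fin (Module.finrank ℝ W) => (LieModule.toEnd ℝ L L Y ^ (i : ℕ)) V) := by
  obtain ⟨n, hn⟩ := P.exists_nat
  have hVK : V ∈ loweringSpan t hS P hn := Submodule.subset_span ⟨0, by simp⟩
  have hYS : Y ∈ S := by
    change Y ∈ S.toSubmodule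
    rw [hS]
    exact Submodule.subset_span (by simp)
  have hψW (i : ℕ) : (LieModule.toEnd ℝ L L Y ^ i) V ∈ W := by
    induction i with
    | zero => simpa using hV
    | succ i ih =>
      rw [← P.lie_f_pow_toEnd_f i]
      exact W.lie_mem (x := (⟨Y, hYS⟩ : S)) ih
  have htop : (loweringSpan t hS P hn).comap W.incl = ⊤ := by
    refine (eq_bot_or_eq_top _).resolve_left fun hbot => P.ne_zero ?_
    have : (⟨V, hV⟩ : W) ∈ (loweringSpan t hS P hn).comap W.incl := hVK
    rw [hbot, LieSubmodule.mem_bot] at this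
    exact congrArg Subtype.val this
  have hWK : W.toSubmodule = Submodule.span ℝ
      (range fun i : Fin (n + 1) => (LieModule.toEnd ℝ L L Y ^ (i : ℕ)) V) := by
    refine le_antisymm (fun w hw => ?_) (Submodule.span_le.2 ?_)
    · have : (⟨w, hw⟩ : W) ∈ (loweringSpan t hS P hn).comap W.incl := by
        rw [htop]; exact LieSubmodule.mem_top _
      exact this
    · rintro _ ⟨i, rfl⟩
      exact hψW i
  have hli : LinearIndependent ℝ
      (fun i : Fin (n + 1) => (LieModule.toEnd ℝ L L Y ^ (i : ℕ)) V) :=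
    Module.End.eigenvectors_linearIndependent' (LieModule.toEnd ℝ L L H)
      (fun i : Fin (n + 1) => μ - 2 * (i : ℕ))
      (fun i j hij => Fin.ext (by
        have : (i : ℕ) = ((j : ℕ) : ℝ) := by simpa using hij
        exact_mod_cast this)) _
      (fun i => ⟨Module.End.mem_eigenspace_iff.2 (P.lie_h_pow_toEnd_f i),
        P.pow_toEnd_f_ne_zero_of_eq_nat hn (Nat.le_of_lt_succ i.2)⟩)
  have hdim : Module.finrank ℝ W = n + 1 := by
    change Module.finrank ℝ W.toSubmodule = n + 1
    rw [hWK, finrank_span_eq_card hli, Fintype.card_fin]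
  rw [hdim, hn]
  exact ⟨by simp, hWK⟩

end IsSl2Triple

/-! ### The fields in canonical coordinates -/

namespace PlaneField

variable {D : Opens Plane} {X V H Y Z : PlaneField D}

theorem fderiv_eq_zero_of_const {v : PlaneField D} {c : Plane} (h : ∀ z ∈ D, v z = c) {z : Plane}
    (hz : z ∈ D) : fderiv ℝ v z = 0 := by
  have : (v : Plane → Plane) =ᶠ[𝓝 z] fun _ => c := by
    filter_upwards [D.isOpen.mem_nhds hz] with w hw using h w hw
  rw [this.fderiv_eq]
  simp

theorem contDiffOn_snd (v : PlaneField D) : ContDiffOn ℝ ∞ (fun z => (v z).2) D := v.2.1.snd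

theorem contDiffOn_fst (v : PlaneField D) : ContDiffOn ℝ ∞ (fun z => (v z).1) D := v.2.1.fst

theorem fderiv_snd_apply (v : PlaneField D) {z : Plane} (hz : z ∈ D) (a : Plane) :
    fderiv ℝ (fun z => (v z).2) z a = (fderiv ℝ v z a).2 := by
  rw [(PlaneField.differentiableAt v hz).hasFDerivAt.snd.fderiv]
  rfl

/-- A field that acts diagonally on `∂x` and `∂y` is affine. -/
theorem exists_eq_affine (hD : IsPreconnected (D : Set Plane)) {lam μ : ℝ}
    (hX : ∀ z ∈ D, X z = (1, 0)) (hV : ∀ z ∈ D, V z = (0, 1))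
    (hHX : ⁅H, X⁆ = lam • X) (hHV : ⁅H, V⁆ = μ • V) :
    ∃ c : Plane, ∀ z ∈ D, H z = (-lam * z.1 + c.1, -μ * z.2 + c.2) := by
  set L : Plane →L[ℝ] Plane := planeFrame (-lam, 0) (0, -μ) with hL
  have hf : ∀ z ∈ D, fderiv ℝ H z = L := by
    intro z hz
    have h1 : (⁅H, X⁆ : PlaneField D) z = lam • X z := by rw [hHX]; rfl
    have h2 : (⁅H, V⁆ : PlaneField D) z = μ • V z := by rw [hHV]; rfl
    rw [bracket_apply_fderiv _ _ hz, fderiv_eq_zero_of_const hX hz, hX z hz] at h1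
    rw [bracket_apply_fderiv _ _ hz, fderiv_eq_zero_of_const hV hz, hV z hz] at h2
    refine clm_plane_ext ?_ ?_
    · rw [_root_.zero_apply, zero_sub] at h1
      rw [← neg_neg (fderiv ℝ H z (1, 0)), h1, hL, planeFrame_apply]
      simp
    · rw [_root_.zero_apply, zero_sub] at h2
      rw [← neg_neg (fderiv ℝ H z (0, 1)), h2, hL, planeFrame_apply]
      simp
  obtain ⟨c, hc⟩ := D.isOpen.exists_eq_add_of_fderiv_eq hD
    (fun z hz => (PlaneField.differentiableAt H hz).differentiableWithinAt)
    L.differentiable.differentiableOn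
    (fun z hz => by rw [hf z hz]; exact L.fderiv.symm)
  refine ⟨c, fun z hz => ?_⟩
  rw [hc hz]
  change planeFrame (-lam, 0) (0, -μ) z + c = _
  rw [planeFrame_apply]
  ext <;> simp [mul_comm]

theorem fderiv_linear {lam μ : ℝ} (hH : ∀ z ∈ D, H z = (-lam * z.1, -μ * z.2)) {z : Plane}
    (hz : z ∈ D) (a : Plane) : fderiv ℝ H z a = (-lam * a.1, -μ * a.2) := by
  have hev : (H : Plane → Plane) =ᶠ[𝓝 z] planeFrame (-lam, 0) (0, -μ) := by
    filter_upwards [D.isOpen.mem_nhds hz] with w hw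
    rw [hH w hw, planeFrame_apply]
    ext <;> simp [mul_comm]
  rw [hev.fderiv_eq, ContinuousLinearMap.fderiv, planeFrame_apply]
  ext <;> simp [mul_comm]

/-- With `X = ∂x`, `V = ∂y` and `H` linear, the relations of the algebra determine `Y` and the
generator `Z` of the trivial summand. The weights of `H` alone leave a summand `h(y) ∂y` of `Y`
undetermined; it vanishes because `Y` commutes with `Z`. -/
theorem eq_of_relations (hD : IsPreconnected (D : Set Plane)) {μ : ℝ} (hμ : μ ≠ 0)
    (hX : ∀ z ∈ D, X z = (1, 0)) (hV : ∀ z ∈ D, V z = (0, 1))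
    (hH : ∀ z ∈ D, H z = (-2 * z.1, -μ * z.2))
    (hXY : ⁅X, Y⁆ = H) (hHY : ⁅H, Y⁆ = -((2 : ℝ) • Y))
    (hYV : ∀ z ∈ D, ((⁅Y, V⁆ : PlaneField D) z).1 = 0) (hZ₁ : ∀ z ∈ D, (Z z).1 = 0)
    (hXZ : ⁅X, Z⁆ = 0) (hHZ : ⁅H, Z⁆ = 0) (hYZ : ⁅Y, Z⁆ = 0) (hZ : Z ≠ 0) :
    (∀ z ∈ D, Y z = (-z.1 ^ 2, -μ * (z.1 * z.2))) ∧
      ∃ C : ℝ, C ≠ 0 ∧ ∀ z ∈ D, Z z = (0, C * z.2) := by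
  have hYx : ∀ z ∈ D, fderiv ℝ Y z (1, 0) = H z := fun z hz => by
    have h := bracket_apply_fderiv X Y hz
    rw [hXY, fderiv_eq_zero_of_const hX hz, hX z hz] at h
    simpa using h.symm
  have hYy : ∀ z ∈ D, (fderiv ℝ Y z (0, 1)).1 = 0 := fun z hz => by
    have h := hYV z hz
    rw [bracket_apply_fderiv Y V hz, fderiv_eq_zero_of_const hV hz, hV z hz] at h
    simpa using h
  have hY : ∀ z ∈ D, (Y z).1 = -z.1 ^ 2 ∧
      2 * μ * (z.1 * z.2) - μ * z.2 * (fderiv ℝ Y z (0, 1)).2 + (μ + 2) * (Y z).2 = 0 := by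
    intro z hz
    have h : (⁅H, Y⁆ : PlaneField D) z = -((2 : ℝ) • Y z) := by rw [hHY]; rfl
    rw [bracket_apply_fderiv H Y hz, fderiv_linear hH hz, clm_plane_apply _ (H z), hYx z hz,
      hH z hz] at h
    have h1 := congrArg Prod.fst h
    have h2 := congrArg Prod.snd h
    simp [hYy z hz] at h1 h2
    exact ⟨by linarith, by linarith⟩
  set k : Plane → ℝ := fun z => (Z z).2 with hk
  have hks : ContDiffOn ℝ ∞ k D := contDiffOn_snd Z
  have hkx : ∀ z ∈ D, partialX k z = 0 := fun z hz => by
    have h := bracket_apply_fderiv X Z hz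
    rw [hXZ, fderiv_eq_zero_of_const hX hz, hX z hz] at h
    rw [partialX, hk, fderiv_snd_apply Z hz]
    have h' := congrArg Prod.snd h
    simpa using h'.symm
  have hky : ∀ z ∈ D, k z = z.2 * partialY k z := fun z hz => by
    have h := congrArg Prod.snd (bracket_apply_fderiv H Z hz)
    rw [hHZ, fderiv_linear hH hz, Prod.snd_sub, ← fderiv_snd_apply Z hz, fderiv_eq_partial,
      hH z hz] at h
    change 0 = -2 * z.1 * partialX k z + -μ * z.2 * partialY k z - -μ * k z at h
    rw [hkx z hz] at h
    have : μ * (k z - z.2 * partialY k z) = 0 := by linarith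
    linarith [(mul_eq_zero.1 this).resolve_left hμ]
  have hYk : ∀ z ∈ D, (Y z).2 * partialY k z = k z * (fderiv ℝ Y z (0, 1)).2 := fun z hz => by
    have h := congrArg Prod.snd (bracket_apply_fderiv Y Z hz)
    rw [hYZ, Prod.snd_sub, ← fderiv_snd_apply Z hz, fderiv_eq_partial, clm_plane_apply _ (Z z),
      hZ₁ z hz] at h
    change 0 = (Y z).1 * partialX k z + (Y z).2 * partialY k z
      - ((0 : ℝ) • fderiv ℝ Y z (1, 0) + k z • fderiv ℝ Y z (0, 1)).2 at h
    rw [hkx z hz] at h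
    simp at h
    linarith
  -- Euler's equation `y ∂k/∂y = k` forces `k` to be linear in `y`, also across the axis `y = 0`
  have hgs : ContDiffOn ℝ ∞ (partialY k) D := hks.partialY D.isOpen
  have hgx : ∀ z ∈ D, partialX (partialY k) z = 0 := fun z hz => by
    rw [partialX_partialY_comm hks D.isOpen hz, partialY_congr D.isOpen hkx hz, partialY_const]
  have hgy : ∀ z ∈ D, partialY (partialY k) z = 0 := by
    refine eq_zero_of_snd_mul_eq_zero (hgs.partialY D.isOpen).continuousOn D.isOpen fun z hz => ?_
    have h1 := partialY_congr D.isOpen hky hz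
    have h2 := (hasFDerivAt_snd (𝕜 := ℝ) (p := z)).mul
      (hgs.differentiableAt_of_isOpen D.isOpen hz).hasFDerivAt
    have h3 : partialY (fun z => z.2 * partialY k z) z
        = z.2 * partialY (partialY k) z + partialY k z := by
      change fderiv ℝ (Prod.snd * partialY k) z (0, 1) = _
      rw [h2.fderiv]
      simp [partialY]
    linarith
  obtain ⟨C, hC⟩ := exists_const_of_partial_eq_zero hgs D.isOpen hD hgx hgy
  have hkC : ∀ z ∈ D, k z = C * z.2 := fun z hz => by rw [hky z hz, hC z hz, mul_comm]
  have hC0 : C ≠ 0 := by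
    rintro rfl
    refine hZ (PlaneField.ext_on fun z hz => ?_)
    have h2 : (Z z).2 = 0 := by simpa using hkC z hz
    exact Prod.ext (hZ₁ z hz) h2
  refine ⟨fun z hz => ?_, C, hC0, fun z hz => Prod.ext (hZ₁ z hz) (hkC z hz)⟩
  have hcont : ContinuousOn (fun z : Plane => (Y z).2 + μ * (z.1 * z.2)) D := by
    have := (contDiffOn_snd Y).continuousOn
    fun_prop
  have h0 : (Y z).2 + μ * (z.1 * z.2) = 0 := by
    refine eq_zero_of_snd_mul_eq_zero hcont D.isOpen (fun z hz => ?_) z hz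
    have e1 := (hY z hz).2
    have e2 := hYk z hz
    have e3 := hky z hz
    rw [hC z hz] at e2 e3
    have : C * (z.2 * ((Y z).2 + μ * (z.1 * z.2))) = 0 := by
      rw [e3] at e2
      linear_combination (1 / 2 * C * z.2) * e1 - (1 / 2 * μ * z.2) * e2
    exact (mul_eq_zero.1 this).resolve_left hC0
  exact Prod.ext (hY z hz).1 (by simp only; linarith)

/-- The lowering orbit of `∂y` under `Y = -x² ∂x - μ x y ∂y`. -/
theorem lowering_orbit {μ : ℝ} (hV : ∀ z ∈ D, V z = (0, 1))
    (hY : ∀ z ∈ D, Y z = (-z.1 ^ 2, -μ * (z.1 * z.2))) (v : ℕ → PlaneField D) (h0 : v 0 = V)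
    (hs : ∀ i, v (i + 1) = ⁅Y, v i⁆) (i : ℕ) :
    ∀ z ∈ D, v i z = (0, (∏ j ∈ Finset.range i, (μ - j)) * z.1 ^ i) := by
  induction i with
  | zero => intro z hz; simp [h0, hV z hz]
  | succ i ih =>
    intro z hz
    set c := ∏ j ∈ Finset.range i, (μ - j) with hc
    have hYy : fderiv ℝ Y z (0, 1) = (0, -μ * z.1) := by
      have hev : (Y : Plane → Plane) =ᶠ[𝓝 z]
          fun w => ((fun x : ℝ => -x ^ 2) w.1, (fun x : ℝ => -μ * x) w.1 * w.2) := by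
        filter_upwards [D.isOpen.mem_nhds hz] with w hw
        rw [hY w hw, mul_assoc]
      have h1 : HasDerivAt (fun x : ℝ => -x ^ 2) (-(2 * z.1)) z.1 := by
        simpa using (hasDerivAt_pow 2 z.1).fun_neg
      have h2 : HasDerivAt (fun x : ℝ => -μ * x) (-μ) z.1 := by
        simpa using (hasDerivAt_id' z.1).const_mul (-μ)
      rw [hev.fderiv_eq,
        ((hasFDerivAt_comp_fst h1).prodMk (hasFDerivAt_comp_fst_mul_snd h2)).fderiv]
      simp
    have hv : fderiv ℝ (v i) z (Y z) = (0, c * (i * z.1 ^ (i - 1)) * -z.1 ^ 2) := by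
      have hev : (v i : Plane → Plane) =ᶠ[𝓝 z] fun w => ((0 : ℝ), (fun x : ℝ => c * x ^ i) w.1) := by
        filter_upwards [D.isOpen.mem_nhds hz] with w hw using ih w hw
      rw [hev.fderiv_eq, ((hasFDerivAt_const (0 : ℝ) z).prodMk
        (hasFDerivAt_comp_fst ((hasDerivAt_pow i z.1).const_mul c))).fderiv, hY z hz]
      simp
    rw [hs, bracket_apply_fderiv _ _ hz, hv, ih z hz, clm_plane_apply, hYy,
      Finset.prod_range_succ, ← hc]
    ext
    · simp
    · rcases i with _ | i
      · simp; ring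
      · simp; ring

end PlaneField

/-! ### Prolongation along graphs -/

/-- The `(n - 1)`-jet at `x` of the function `u`, in the coordinates `(x; y, y', …, y⁽ⁿ⁻¹⁾)`. -/
noncomputable def jetOf (n : ℕ) (u : ℝ → ℝ) (x : ℝ) : JetCoords n :=
  (x, fun i => iteratedDeriv i u x)

/-- The characteristic `η - ξ y'` of the field `w = ξ ∂x + η ∂y`, evaluated along the graph of
`u`. -/
noncomputable def characteristic (w : Plane → Plane) (u : ℝ → ℝ) (x : ℝ) : ℝ :=
  (w (x, u x)).2 - (w (x, u x)).1 * deriv u x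

theorem base_jetOf {n : ℕ} (u : ℝ → ℝ) (x : ℝ) : (jetOf (n + 1) u x).base = (x, u x) := by
  simp [jetOf, JetCoords.base]

theorem hasDerivAt_iteratedDeriv {u : ℝ → ℝ} {x : ℝ} (hu : ContDiffAt ℝ ∞ u x) (k : ℕ) :
    HasDerivAt (iteratedDeriv k u) (iteratedDeriv (k + 1) u x) x := by
  rw [iteratedDeriv_succ, hasDerivAt_deriv_iff]
  have := (contDiffWithinAt_univ.2 hu).differentiableWithinAt_iteratedDerivWithin (m := k)
    (by exact_mod_cast ENat.natCast_lt_top k) (by simp)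
  rwa [iteratedDerivWithin_univ, differentiableWithinAt_univ] at this

theorem hasDerivAt_jetOf {u : ℝ → ℝ} (hu : ContDiff ℝ ∞ u) (n : ℕ) (x : ℝ) :
    HasDerivAt (jetOf n u) (1, fun i => iteratedDeriv (i + 1) u x) x :=
  (hasDerivAt_id x).prodMk (hasDerivAt_pi.2 fun i => hasDerivAt_iteratedDeriv hu.contDiffAt i)

theorem contDiff_base (n : ℕ) : ContDiff ℝ ∞ (JetCoords.base : JetCoords (n + 1) → Plane) := by
  unfold JetCoords.base
  fun_prop

theorem contDiff_trunc {m n : ℕ} (h : m ≤ n) :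
    ContDiff ℝ ∞ (JetCoords.trunc h : JetCoords n → JetCoords m) := by
  unfold JetCoords.trunc
  fun_prop

theorem isOpen_base_mem (D : Opens Plane) (n : ℕ) :
    IsOpen {j : JetCoords (n + 1) | j.base ∈ D} :=
  D.isOpen.preimage (contDiff_base n).continuous

theorem ContDiffOn.totalDeriv {D : Opens Plane} {n : ℕ} {F : JetCoords (n + 1) → ℝ}
    (hF : ContDiffOn ℝ ∞ F {j | j.base ∈ D}) :
    ContDiffOn ℝ ∞ (totalDeriv F) {j : JetCoords (n + 2) | j.base ∈ D} := by
  unfold _root_.totalDeriv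
  refine ContDiffOn.clm_apply ((hF.fderiv_of_isOpen (isOpen_base_mem D n) (by simp)).comp
    (contDiff_trunc _).contDiffOn fun j hj => hj) ?_
  fun_prop

theorem PlaneField.contDiffOn_fst_base {D : Opens Plane} (w : PlaneField D) (n : ℕ) :
    ContDiffOn ℝ ∞ (fun j : JetCoords (n + 1) => (w j.base).1) {j | j.base ∈ D} :=
  (PlaneField.contDiffOn_fst w).comp (contDiff_base n).contDiffOn fun _ hj => hj

theorem PlaneField.contDiffOn_prolongCoeff {D : Opens Plane} (w : PlaneField D) (k : ℕ) :
    ContDiffOn ℝ ∞ (prolongCoeff w k) {j : JetCoords (k + 1) | j.base ∈ D} := by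
  induction k with
  | zero => exact (PlaneField.contDiffOn_snd w).comp (contDiff_base 0).contDiffOn fun _ hj => hj
  | succ k ih =>
    have h : ContDiff ℝ ∞ (fun j : JetCoords (k + 2) => j.2 (Fin.last (k + 1))) := by fun_prop
    exact ih.totalDeriv.sub (h.contDiffOn.mul (PlaneField.contDiffOn_fst_base w k).totalDeriv)

/-- The total derivative is the derivative along prolonged graphs. -/
theorem hasDerivAt_comp_jetOf {D : Opens Plane} {n : ℕ} {F : JetCoords (n + 1) → ℝ}
    (hF : ContDiffOn ℝ ∞ F {j | j.base ∈ D}) {u : ℝ → ℝ} (hu : ContDiff ℝ ∞ u) {x : ℝ}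
    (hx : (x, u x) ∈ D) :
    HasDerivAt (fun t => F (jetOf (n + 1) u t)) (totalDeriv F (jetOf (n + 2) u x)) x := by
  have hmem : jetOf (n + 1) u x ∈ {j : JetCoords (n + 1) | j.base ∈ D} := by
    rw [mem_ofPred_eq, base_jetOf]; exact hx
  have hd : DifferentiableAt ℝ F (jetOf (n + 1) u x) :=
    (hF.contDiffAt ((isOpen_base_mem D n).mem_nhds hmem)).differentiableAt (by simp)
  exact hd.hasFDerivAt.comp_hasDerivAt x (hasDerivAt_jetOf hu (n + 1) x)

theorem PlaneField.contDiffAt_characteristic {D : Opens Plane} (w : PlaneField D) {u : ℝ → ℝ}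
    (hu : ContDiff ℝ ∞ u) {x : ℝ} (hx : (x, u x) ∈ D) :
    ContDiffAt ℝ ∞ (characteristic w u) x :=
  ((PlaneField.contDiffOn_snd w).along_graph D.isOpen hu hx).sub
    (((PlaneField.contDiffOn_fst w).along_graph D.isOpen hu hx).mul
      ((contDiff_infty_iff_deriv.1 hu).2).contDiffAt)

/-- Along the jet of `u` the coefficient `η⁽ᵏ⁾` of the prolongation is
`dᵏ/dxᵏ (η - ξ u') + ξ u⁽ᵏ⁺¹⁾`. -/
theorem PlaneField.prolongCoeff_jetOf {D : Opens Plane} (w : PlaneField D) {u : ℝ → ℝ}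
    (hu : ContDiff ℝ ∞ u) (k : ℕ) : ∀ x, (x, u x) ∈ D →
    prolongCoeff w k (jetOf (k + 1) u x)
      = iteratedDeriv k (characteristic w u) x + (w (x, u x)).1 * iteratedDeriv (k + 1) u x := by
  induction k with
  | zero =>
    intro x hx
    change (w (jetOf 1 u x).base).2 = _
    rw [base_jetOf]
    simp [characteristic]
  | succ k ih =>
    intro x hx
    have h1 := hasDerivAt_comp_jetOf (PlaneField.contDiffOn_prolongCoeff w k) hu hx
    have h2 := hasDerivAt_comp_jetOf (PlaneField.contDiffOn_fst_base w k) hu hx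
    simp only [base_jetOf] at h2
    have h3 := (hasDerivAt_iteratedDeriv (PlaneField.contDiffAt_characteristic w hu hx) k).add
      (h2.mul (hasDerivAt_iteratedDeriv (x := x) hu.contDiffAt (k + 1)))
    have h4 := (h1.congr_of_eventuallyEq (f₁ := iteratedDeriv k (characteristic w u)
        + (fun t => (w (t, u t)).1) * iteratedDeriv (k + 1) u) (by
      filter_upwards [eventually_graph_mem D.isOpen hu.continuous hx] with t ht
      exact (ih t ht).symm)).unique h3
    change totalDeriv (prolongCoeff w k) (jetOf (k + 2) u x)
      - iteratedDeriv (k + 1) u x * totalDeriv (n := k) (fun i => (w i.base).1) (jetOf (k + 2) u x)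
      = _
    rw [h4]
    ring

theorem fderiv_last_coord (N : ℕ) (j a : JetCoords (N + 1)) :
    fderiv ℝ (fun i : JetCoords (N + 1) => i.2 (Fin.last N)) j a = a.2 (Fin.last N) := by
  have := (((ContinuousLinearMap.proj (R := ℝ) (φ := fun _ : Fin (N + 1) => ℝ) (Fin.last N)).comp
    (ContinuousLinearMap.snd ℝ ℝ (Fin (N + 1) → ℝ))).hasFDerivAt (x := j)).fderiv
  exact congrArg (fun L : JetCoords (N + 1) →L[ℝ] ℝ => L a) this

theorem prolong_last (w : Plane → Plane) (N : ℕ) (j : JetCoords (N + 1)) :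
    (prolong w N j).2 (Fin.last N) = prolongCoeff w N j := rfl

section Polynomial

open Polynomial

theorem iteratedDeriv_polynomial (P : ℝ[X]) (k : ℕ) :
    iteratedDeriv k (fun x => P.eval x) = fun x => (derivative^[k] P).eval x := by
  induction k with
  | zero => simp
  | succ k ih =>
    rw [iteratedDeriv_succ, ih, Function.iterate_succ_apply']
    funext x
    exact Polynomial.deriv _

theorem iteratedDeriv_polynomial_eq_zero {P : ℝ[X]} {n k : ℕ} (hP : P.degree < n) (hk : n ≤ k)
    (x : ℝ) : iteratedDeriv k (fun x => P.eval x) x = 0 := by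
  rw [iteratedDeriv_polynomial, iterate_derivative_eq_zero_of_degree_lt
    (hP.trans_le (by exact_mod_cast hk))]
  exact eval_zero

theorem contDiff_polynomial (P : ℝ[X]) : ContDiff ℝ ∞ (fun x => P.eval x) := by
  simpa using P.contDiff_aeval (𝕜 := ℝ) ∞

/-- Hermite interpolation at one point. -/
theorem exists_polynomial_iteratedDeriv_eq (x₀ : ℝ) (a : ℕ → ℝ) (n : ℕ) :
    ∃ P : ℝ[X], P.degree < n ∧
      ∀ k < n, iteratedDeriv k (fun x => P.eval x) x₀ = a k := by
  set Q : ℝ[X] := ∑ i ∈ Finset.range n, monomial i (a i / (i.factorial : ℝ)) with hQ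
  have hdeg : Q.degree < n := by
    refine (degree_sum_le _ _).trans_lt ((Finset.sup_lt_iff (WithBot.bot_lt_coe n)).2
      fun i hi => (degree_monomial_le _ _).trans_lt ?_)
    exact Nat.cast_lt.2 (Finset.mem_range.1 hi)
  refine ⟨taylor (-x₀) Q, by rwa [degree_taylor], fun k hk => ?_⟩
  have h1 : (derivative^[k] (taylor (-x₀) Q)).eval x₀
      = k.factorial • (taylor x₀ (taylor (-x₀) Q)).coeff k := by
    rw [taylor_coeff, ← factorial_smul_hasseDeriv]
    simp
  rw [iteratedDeriv_polynomial]
  simp only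
  rw [h1, taylor_taylor, add_neg_cancel, taylor_zero, hQ, finsetSum_coeff,
    Finset.sum_eq_single k]
  · rw [coeff_monomial, if_pos rfl, nsmul_eq_mul]
    field_simp
  · intro i _ hi
    rw [coeff_monomial, if_neg hi]
  · exact fun h => absurd (Finset.mem_range.2 hk) h

/-- Every `N`-jet with `y⁽ᴺ⁾ = 0` is the jet of a polynomial of degree less than `N`. -/
theorem exists_polynomial_jetOf_eq {N : ℕ} (j : JetCoords (N + 1)) (hj : j.2 (Fin.last N) = 0) :
    ∃ P : ℝ[X], P.degree < N ∧ jetOf (N + 1) (fun x => P.eval x) j.1 = j := by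
  obtain ⟨P, hP, hPj⟩ := exists_polynomial_iteratedDeriv_eq j.1
    (fun k => if h : k < N + 1 then j.2 ⟨k, h⟩ else 0) N
  refine ⟨P, hP, Prod.ext rfl (funext fun i => ?_)⟩
  change iteratedDeriv i _ _ = _
  refine Fin.lastCases ?_ (fun i => ?_) i
  · rw [hj]
    exact iteratedDeriv_polynomial_eq_zero hP le_rfl _
  · have := hPj i i.2
    rw [dif_pos (Nat.lt_succ_of_lt i.2)] at this
    exact this

/-- The symmetries of `y⁽ᴺ⁾ = 0` are the fields whose characteristic, along every solution, is
again annihilated by `dᴺ/dxᴺ`. -/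
theorem mem_pointSymmetries_iff {D : Opens Plane} {N : ℕ} {w : PlaneField D} :
    w ∈ pointSymmetries N D ↔ ∀ P : ℝ[X], P.degree < N → ∀ x, (x, P.eval x) ∈ D →
      iteratedDeriv N (characteristic w fun x => P.eval x) x = 0 := by
  have key (P : ℝ[X]) (hP : P.degree < N) (x : ℝ) (hx : (x, P.eval x) ∈ D) :
      prolongCoeff w N (jetOf (N + 1) (fun x => P.eval x) x)
        = iteratedDeriv N (characteristic w fun x => P.eval x) x := by
    rw [PlaneField.prolongCoeff_jetOf w (contDiff_polynomial P) N x hx,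
      iteratedDeriv_polynomial_eq_zero hP (Nat.le_succ N), mul_zero, add_zero]
  constructor
  · intro h P hP x hx
    have := h (jetOf (N + 1) (fun x => P.eval x) x) (by rw [base_jetOf]; exact hx)
      (iteratedDeriv_polynomial_eq_zero hP le_rfl x)
    rw [fderiv_last_coord, prolong_last] at this
    rw [← key P hP x hx, this]
  · intro h j hj hj0
    obtain ⟨P, hP, hPj⟩ := exists_polynomial_jetOf_eq j hj0
    have hx : (j.1, P.eval j.1) ∈ D := by
      rw [← hPj, base_jetOf] at hj
      exact hj
    rw [fderiv_last_coord, prolong_last, ← hPj, key P hP j.1 hx]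
    exact h P hP j.1 hx

end Polynomial

/-! ### Point symmetries of `y⁽ᴺ⁾ = 0` -/

theorem iterate_partialX_eq_iteratedDeriv {E : Set Plane} (hE : IsOpen E) {f : Plane → ℝ}
    (hf : ContDiffOn ℝ ∞ f E) (n : ℕ) : ∀ x s : ℝ, (x, s) ∈ E →
    partialX^[n] f (x, s) = iteratedDeriv n (fun t => f (t, s)) x := by
  induction n with
  | zero => intro x s _; simp
  | succ n ih =>
    intro x s hx
    have h1 := hasDerivAt_along_graph (hasDerivAt_const x s)
      ((hf.iterate_partialX hE n).differentiableAt_of_isOpen hE hx)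
    rw [zero_mul, add_zero] at h1
    rw [Function.iterate_succ_apply', iteratedDeriv_succ, ← h1.deriv]
    refine EventuallyEq.deriv_eq ?_
    filter_upwards [eventually_graph_mem hE (u := fun _ => s) continuous_const hx] with t ht
    exact ih t s ht

/-- The Leibniz rule for a product with a power of `x - x₀`, at `x₀`. -/
theorem iteratedDeriv_sub_pow_mul (m j : ℕ) {g : ℝ → ℝ} {x₀ : ℝ} (hg : ContDiffAt ℝ ∞ g x₀) :
    (j.factorial : ℝ) * iteratedDeriv (m + j) (fun x => (x - x₀) ^ m * g x) x₀
      = (m + j).factorial * iteratedDeriv j g x₀ := by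
  have hpow (i : ℕ) : iteratedDeriv i (fun x : ℝ => (x - x₀) ^ m) x₀
      = if i = m then (m.factorial : ℝ) else 0 := by
    rw [congrFun (iteratedDeriv_comp_sub_const i (fun x : ℝ => x ^ m) x₀) x₀, sub_self,
      iteratedDeriv_fun_pow_zero]
    split_ifs <;> simp
  rw [iteratedDeriv_fun_mul (by fun_prop) (hg.of_le (by exact_mod_cast le_top)),
    Finset.sum_eq_single m]
  · rw [hpow, if_pos rfl, Nat.add_sub_cancel_left]
    have h : (((m + j).choose m * m.factorial * j.factorial : ℕ) : ℝ) = (m + j).factorial := by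
      rw [Nat.choose_symm_add, Nat.add_choose_mul_factorial_mul_factorial]
    rw [← h]
    push_cast
    ring
  · intro i _ hi
    rw [hpow, if_neg hi]
    ring
  · intro h
    exact absurd (Finset.mem_range.2 (by omega)) h

section

open Polynomial

variable {D : Opens Plane} {N : ℕ} {w : PlaneField D}

/-- The symmetry condition, linearised at the solution `P` in the direction of the solution `Q`. -/
theorem iteratedDeriv_linearised_eq_zero (hw : w ∈ pointSymmetries N D) {P Q : ℝ[X]}
    (hP : P.degree < N) (hQ : Q.degree < N) {x₀ : ℝ} (hx : (x₀, P.eval x₀) ∈ D) :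
    iteratedDeriv N (fun x => Q.eval x * (partialY (fun z => (w z).2) (x, P.eval x)
        - partialY (fun z => (w z).1) (x, P.eval x) * P.derivative.eval x)
      - Q.derivative.eval x * (w (x, P.eval x)).1) x₀ = 0 := by
  -- the characteristic along `P + s Q`, as a function of `(x, s)`
  set ρ : Plane → Plane := fun z => (z.1, P.eval z.1 + z.2 * Q.eval z.1) with hρ
  set G : Plane → ℝ := fun z => (w (ρ z)).2
    - (w (ρ z)).1 * (P.derivative.eval z.1 + z.2 * Q.derivative.eval z.1) with hG
  have hev (R : ℝ[X]) : ContDiff ℝ ∞ (fun z : Plane => R.eval z.1) :=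
    (contDiff_polynomial R).comp contDiff_fst
  have hρs : ContDiff ℝ ∞ ρ :=
    contDiff_fst.prodMk ((hev P).add (contDiff_snd.mul (hev Q)))
  set E : Set Plane := ρ ⁻¹' D with hE
  have hEo : IsOpen E := D.isOpen.preimage hρs.continuous
  have hGs : ContDiffOn ℝ ∞ G E :=
    ((PlaneField.contDiffOn_snd w).comp hρs.contDiffOn fun _ hz => hz).sub
      (((PlaneField.contDiffOn_fst w).comp hρs.contDiffOn fun _ hz => hz).mul
        ((hev _).add (contDiff_snd.mul (hev _))).contDiffOn)
  have hG0 : ∀ z ∈ E, partialX^[N] G z = 0 := by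
    rintro ⟨x, s⟩ hz
    have hz' : (x, (P + s • Q).eval x) ∈ D := by simpa [hE, hρ] using hz
    have hdeg : (P + s • Q).degree < N :=
      (degree_add_le _ _).trans_lt (max_lt hP ((degree_smul_le s Q).trans_lt hQ))
    rw [iterate_partialX_eq_iteratedDeriv hEo hGs N x s hz,
      ← mem_pointSymmetries_iff.1 hw _ hdeg x hz']
    congr 1
    funext t
    simp only [characteristic, Polynomial.deriv, hG, hρ]
    simp
  have hG1 : iteratedDeriv N (fun t => partialY G (t, 0)) x₀ = 0 := by
    have hz : ((x₀, 0) : Plane) ∈ E := by simpa [hE, hρ] using hx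
    rw [← iterate_partialX_eq_iteratedDeriv hEo (hGs.partialY hEo) N x₀ 0 hz,
      iterate_partialX_partialY_comm hGs hEo N hz, partialY_congr hEo hG0 hz, partialY_const]
  rw [← hG1]
  refine EventuallyEq.iteratedDeriv_eq N ?_
  filter_upwards [eventually_graph_mem D.isOpen (contDiff_polynomial P).continuous hx] with x hx'
  have hz : ((x, 0) : Plane) ∈ E := by simpa [hE, hρ] using hx'
  have hline : HasDerivAt (fun s : ℝ => ((x, s) : Plane)) (0, 1) 0 :=
    (hasDerivAt_const 0 x).prodMk (hasDerivAt_id' 0)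
  have h1 := (hGs.differentiableAt_of_isOpen hEo hz).hasFDerivAt.comp_hasDerivAt (0 : ℝ) hline
  have hρl : HasDerivAt (fun s : ℝ => ((x, P.eval x + s * Q.eval x) : Plane)) (0, Q.eval x) 0 :=
    (hasDerivAt_const 0 x).prodMk
      (by simpa using ((hasDerivAt_id' (0 : ℝ)).mul_const (Q.eval x)).const_add (P.eval x))
  have hx'' : ((x, P.eval x + 0 * Q.eval x) : Plane) ∈ D := by simpa using hx'
  have h2 := ((PlaneField.contDiffOn_snd w).differentiableAt_of_isOpen D.isOpen
    hx'').hasFDerivAt.comp_hasDerivAt (0 : ℝ) hρl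
  have h3 := ((PlaneField.contDiffOn_fst w).differentiableAt_of_isOpen D.isOpen
    hx'').hasFDerivAt.comp_hasDerivAt (0 : ℝ) hρl
  have h4 : HasDerivAt (fun s : ℝ => P.derivative.eval x + s * Q.derivative.eval x)
      (Q.derivative.eval x) 0 := by
    simpa using ((hasDerivAt_id' (0 : ℝ)).mul_const (Q.derivative.eval x)).const_add
        (P.derivative.eval x)
  have h5 := h1.unique (h2.sub (h3.mul h4))
  change _ = fderiv ℝ G (x, 0) (0, 1)
  rw [h5, fderiv_eq_partial, fderiv_eq_partial]
  simp
  ring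

/-- The linearised symmetry condition in the direction `(x - x₀)ᵐ`, `m = N - j`, at `x₀`. -/
theorem linearised_symmetry (hw : w ∈ pointSymmetries N D) {P : ℝ[X]} (hP : P.degree < N)
    {m j : ℕ} (hmj : m + 1 + j = N) (hj : 0 < j) {x₀ : ℝ} (hx : (x₀, P.eval x₀) ∈ D) :
    ((j : ℝ) + 1) * iteratedDeriv j (fun x => partialY (fun z => (w z).2) (x, P.eval x)
        - partialY (fun z => (w z).1) (x, P.eval x) * P.derivative.eval x) x₀
      = ((m : ℝ) + 1) * iteratedDeriv (j + 1) (fun x => (w (x, P.eval x)).1) x₀ := by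
  set a : ℝ → ℝ := fun x => partialY (fun z => (w z).2) (x, P.eval x)
        - partialY (fun z => (w z).1) (x, P.eval x) * P.derivative.eval x with ha
  set b : ℝ → ℝ := fun x => (w (x, P.eval x)).1 with hb
  have has : ContDiffAt ℝ ∞ a x₀ :=
    (((PlaneField.contDiffOn_snd w).partialY D.isOpen).along_graph D.isOpen
      (contDiff_polynomial P) hx).sub
      ((((PlaneField.contDiffOn_fst w).partialY D.isOpen).along_graph D.isOpen
        (contDiff_polynomial P) hx).mul (contDiff_polynomial _).contDiffAt)
  have hbs : ContDiffAt ℝ ∞ b x₀ :=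
    (PlaneField.contDiffOn_fst w).along_graph D.isOpen (contDiff_polynomial P) hx
  have hQ : ((X - C x₀) ^ (m + 1)).degree < (N : WithBot ℕ) := by
    rw [degree_pow, degree_X_sub_C, nsmul_eq_mul, mul_one]
    exact Nat.cast_lt.2 (by omega)
  have h := iteratedDeriv_linearised_eq_zero hw hP hQ hx
  have hfun : (fun x => ((X - C x₀) ^ (m + 1)).eval x * a x
      - (derivative ((X - C x₀) ^ (m + 1))).eval x * b x)
      = fun x => (x - x₀) ^ (m + 1) * a x - (x - x₀) ^ m * (((m : ℝ) + 1) * b x) := by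
    funext x
    rw [derivative_pow]
    simp
    ring
  change iteratedDeriv N (fun x => ((X - C x₀) ^ (m + 1)).eval x * a x
      - (derivative ((X - C x₀) ^ (m + 1))).eval x * b x) x₀ = 0 at h
  rw [hfun] at h
  have hbm : ContDiffAt ℝ ∞ (fun x => ((m : ℝ) + 1) * b x) x₀ := contDiffAt_const.mul hbs
  have hle : ((N : ℕ) : WithTop ℕ∞) ≤ ∞ := by exact_mod_cast le_top
  have hsub := iteratedDeriv_sub (n := N) (x := x₀) (f := fun x => (x - x₀) ^ (m + 1) * a x)
    (g := fun x => (x - x₀) ^ m * (((m : ℝ) + 1) * b x))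
    (ContDiffAt.mul (by fun_prop) (has.of_le hle)) (ContDiffAt.mul (by fun_prop) (hbm.of_le hle))
  have h0 : iteratedDeriv N (fun x => (x - x₀) ^ (m + 1) * a x) x₀
      = iteratedDeriv N (fun x => (x - x₀) ^ m * (((m : ℝ) + 1) * b x)) x₀ :=
    sub_eq_zero.1 (hsub.symm.trans h)
  have e1 := iteratedDeriv_sub_pow_mul (m + 1) j has
  have e2 := iteratedDeriv_sub_pow_mul m (j + 1) hbm
  rw [hmj] at e1
  rw [show m + (j + 1) = N by omega, iteratedDeriv_const_mul_field] at e2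
  rw [h0] at e1
  have hN : (N.factorial : ℝ) ≠ 0 := by positivity
  rw [Nat.factorial_succ] at e2
  push_cast at e2
  refine mul_left_cancel₀ hN ?_
  linear_combination e2 - ((j : ℝ) + 1) * e1

/-- The determining equations of the symmetries of `y⁽ᴺ⁾ = 0`, for `N ≥ 3`. -/
theorem determining_equations (hN : 3 ≤ N) (hw : w ∈ pointSymmetries N D) :
    (∀ z ∈ D, partialY (fun z => (w z).1) z = 0) ∧
    (∀ z ∈ D, partialX^[3] (fun z => (w z).1) z = 0) ∧
    (∀ z ∈ D, partialY (partialY fun z => (w z).2) z = 0) ∧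
    (∀ z ∈ D, 2 * partialX (partialY fun z => (w z).2) z
      = ((N : ℝ) - 1) * partialX (partialX fun z => (w z).1) z) ∧
    (∀ z ∈ D, partialX^[N] (fun z => (w z).2) z = 0) := by
  set ξ : Plane → ℝ := fun z => (w z).1 with hξ
  set η : Plane → ℝ := fun z => (w z).2 with hη
  have hξs : ContDiffOn ℝ ∞ ξ D := PlaneField.contDiffOn_fst w
  have hηs : ContDiffOn ℝ ∞ η D := PlaneField.contDiffOn_snd w
  have hDo : IsOpen (D : Set Plane) := D.isOpen
  have hN' : (3 : ℝ) ≤ N := by exact_mod_cast hN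
  -- the direction `(x - x₀)ᴺ⁻¹` at the quadratic solutions
  have h1 : ∀ z ∈ D, ∀ p r : ℝ,
      2 * (partialX (partialY η) z + p * partialY (partialY η) z
        - ((partialX (partialY ξ) z + p * partialY (partialY ξ) z) * p
          + partialY ξ z * (2 * r)))
      = ((N : ℝ) - 1) * (partialX (partialX ξ) z + p * partialY (partialX ξ) z
        + (2 * r * partialY ξ z
          + p * (partialX (partialY ξ) z + p * partialY (partialY ξ) z))) := by
    rintro ⟨x₀, y₀⟩ hz p r
    set P : ℝ[X] := C y₀ + C p * (X - C x₀) + C r * (X - C x₀) ^ 2 with hPdef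
    have hP : P.degree < N := by
      have hd : P.degree ≤ (2 : ℕ) := by
        refine degree_le_of_natDegree_le ?_
        rw [hPdef]
        compute_degree
      exact hd.trans_lt (Nat.cast_lt.2 hN)
    have hP' : ∀ x, P.derivative.eval x = p + 2 * r * (x - x₀) := by
      intro x
      simp [hPdef, derivative_pow]
      ring
    have hP0 : P.eval x₀ = y₀ := by simp [hPdef]
    have hPx : (x₀, P.eval x₀) ∈ D := by rwa [hP0]
    have key := linearised_symmetry hw hP (m := N - 2) (j := 1) (by omega) one_pos hPx
    have hu : ∀ x, HasDerivAt (fun x => P.eval x) (P.derivative.eval x) x := P.hasDerivAt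
    have hu' : HasDerivAt (fun x => P.derivative.eval x) (2 * r) x₀ := by
      have := (((hasDerivAt_id' x₀).sub_const x₀).const_mul (2 * r)).const_add p
      rw [mul_one] at this
      exact this.congr_of_eventuallyEq (Eventually.of_forall hP')
    have hA := ((hasDerivAt_along_graph (hu x₀)
        ((hηs.partialY hDo).differentiableAt_of_isOpen hDo hPx)).sub
      ((hasDerivAt_along_graph (hu x₀)
        ((hξs.partialY hDo).differentiableAt_of_isOpen hDo hPx)).mul hu')).deriv
    have hB : iteratedDeriv 2 (fun x => ξ (x, P.eval x)) x₀
        = partialX (partialX ξ) (x₀, P.eval x₀)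
          + P.derivative.eval x₀ * partialY (partialX ξ) (x₀, P.eval x₀)
          + (2 * r * partialY ξ (x₀, P.eval x₀)
            + P.derivative.eval x₀ * (partialX (partialY ξ) (x₀, P.eval x₀)
              + P.derivative.eval x₀ * partialY (partialY ξ) (x₀, P.eval x₀))) := by
      rw [iteratedDeriv_succ, iteratedDeriv_one]
      refine ((EventuallyEq.deriv_eq ?_).trans
        ((hasDerivAt_along_graph (hu x₀)
          ((hξs.partialX hDo).differentiableAt_of_isOpen hDo hPx)).add (hu'.mul
        (hasDerivAt_along_graph (hu x₀)
          ((hξs.partialY hDo).differentiableAt_of_isOpen hDo hPx)))).deriv)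
      filter_upwards [eventually_graph_mem hDo (contDiff_polynomial P).continuous hPx] with x hx
      exact (hasDerivAt_along_graph (hu x) (hξs.differentiableAt_of_isOpen hDo hx)).deriv
    rw [iteratedDeriv_one] at key
    have key' := (congrArg (fun t => ((1 : ℕ) + 1 : ℝ) * t) hA).symm.trans
      (key.trans (congrArg (fun t => (((N - 2 : ℕ) : ℝ) + 1) * t) hB))
    rw [Nat.cast_sub (by omega)] at key'
    simp only [hP', hP0, sub_self, mul_zero, add_zero, Nat.cast_one, Nat.cast_ofNat] at key'
    linear_combination key'
  have hξy : ∀ z ∈ D, partialY ξ z = 0 := fun z hz => by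
    have e0 := h1 z hz 0 0
    have e1 := h1 z hz 0 1
    have : (2 * (N : ℝ) + 2) * partialY ξ z = 0 := by linarith
    exact (mul_eq_zero.1 this).resolve_left (by positivity)
  have hξyx : ∀ z ∈ D, partialX (partialY ξ) z = 0 := fun z hz => by
    rw [partialX_congr hDo hξy hz, partialX_const]
  have hξyy : ∀ z ∈ D, partialY (partialY ξ) z = 0 := fun z hz => by
    rw [partialY_congr hDo hξy hz, partialY_const]
  have hηxy : ∀ z ∈ D, 2 * partialX (partialY η) z
      = ((N : ℝ) - 1) * partialX (partialX ξ) z := fun z hz => by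
    have e0 := h1 z hz 0 0
    rw [hξy z hz, hξyx z hz, hξyy z hz] at e0
    linarith
  have hηyy : ∀ z ∈ D, partialY (partialY η) z = 0 := fun z hz => by
    have e0 := h1 z hz 0 0
    have e1 := h1 z hz 1 0
    rw [hξy z hz, ← partialX_partialY_comm hξs hDo hz, hξyx z hz, hξyy z hz] at e0 e1
    linarith
  have hdegC (y₀ : ℝ) : (C y₀ : ℝ[X]).degree < N :=
    degree_C_le.trans_lt (Nat.cast_lt.2 (by omega : 0 < N))
  refine ⟨hξy, ?_, hηyy, hηxy, ?_⟩
  · -- the direction `(x - x₀)ᴺ⁻²` at the constant solutions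
    rintro ⟨x₀, y₀⟩ hz
    have key := linearised_symmetry hw (hdegC y₀) (m := N - 3) (j := 2) (by omega) two_pos
      (x₀ := x₀) (by simpa using hz)
    simp only [derivative_C, eval_C, eval_zero, mul_zero, sub_zero] at key
    have k1 := iterate_partialX_eq_iteratedDeriv hDo (hηs.partialY hDo) 2 x₀ y₀ hz
    have k2 := iterate_partialX_eq_iteratedDeriv hDo hξs 3 x₀ y₀ hz
    have k3 : partialX (fun z => 2 * partialX (partialY η) z) (x₀, y₀)
        = partialX (fun z => ((N : ℝ) - 1) * partialX (partialX ξ) z) (x₀, y₀) :=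
      partialX_congr hDo hηxy hz
    rw [partialX_const_mul (((hηs.partialY hDo).partialX hDo).differentiableAt_of_isOpen hDo hz),
      partialX_const_mul (((hξs.partialX hDo).partialX hDo).differentiableAt_of_isOpen hDo hz)]
      at k3
    change ((2 : ℕ) + 1 : ℝ) * iteratedDeriv 2 (fun t => partialY η (t, y₀)) x₀
      = (((N - 3 : ℕ) : ℝ) + 1) * iteratedDeriv 3 (fun t => ξ (t, y₀)) x₀ at key
    rw [← k1, ← k2, Nat.cast_sub hN] at key
    change ((2 : ℕ) + 1 : ℝ) * partialX (partialX (partialY η)) (x₀, y₀)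
      = ((N : ℝ) - (3 : ℕ) + 1) * partialX (partialX (partialX ξ)) (x₀, y₀) at key
    change partialX (partialX (partialX ξ)) (x₀, y₀) = 0
    push_cast at key
    have : ((N : ℝ) + 1) * partialX (partialX (partialX ξ)) (x₀, y₀) = 0 := by
      linear_combination 2 * key - 3 * k3
    exact (mul_eq_zero.1 this).resolve_left (by positivity)
  · rintro ⟨x₀, y₀⟩ hz
    have key := mem_pointSymmetries_iff.1 hw _ (hdegC y₀) x₀ (by simpa using hz)
    rw [iterate_partialX_eq_iteratedDeriv hDo hηs N x₀ y₀ hz, ← key]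
    congr 1
    funext x
    simp [characteristic, hη]

/-- For `N ≥ 3` the symmetries of `y⁽ᴺ⁾ = 0` over a connected `D` form a space of polynomial
fields of dimension `N + 4`. -/
theorem exists_eq_of_mem_pointSymmetries (hD : IsPreconnected (D : Set Plane)) (hN : 3 ≤ N)
    (hw : w ∈ pointSymmetries N D) :
    ∃ (a : ℕ → ℝ) (d : ℝ) (c : ℕ → ℝ), ∀ z ∈ D,
      w z = (a 0 + a 1 * z.1 + a 2 * z.1 ^ 2,
        (((N : ℝ) - 1) * a 2 * z.1 + d) * z.2 + ∑ i ∈ Finset.range N, c i * z.1 ^ i) := by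
  obtain ⟨hξy, hξx, hηyy, hηxy, hηx⟩ := determining_equations hN hw
  set ξ : Plane → ℝ := fun z => (w z).1 with hξ
  set η : Plane → ℝ := fun z => (w z).2 with hη
  have hξs : ContDiffOn ℝ ∞ ξ D := PlaneField.contDiffOn_fst w
  have hηs : ContDiffOn ℝ ∞ η D := PlaneField.contDiffOn_snd w
  have hDo : IsOpen (D : Set Plane) := D.isOpen
  obtain ⟨a, ha⟩ := exists_polynomial_of_partial_eq_zero hDo hD 3 ξ hξs hξy hξx
  have ha' : ∀ z ∈ D, ξ z = a 0 + a 1 * z.1 + a 2 * z.1 ^ 2 := fun z hz => by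
    rw [ha z hz]; simp [Finset.sum_range_succ]
  have hξ1 : ∀ z ∈ D, partialX ξ z = a 1 + a 2 * 2 * z.1 := fun z hz => by
    rw [partialX_congr hDo ha' hz]
    refine partialX_comp_fst (h := fun x => a 0 + a 1 * x + a 2 * x ^ 2) ?_
    refine ((((hasDerivAt_id' z.1).const_mul (a 1)).const_add (a 0)).add
      ((hasDerivAt_pow 2 z.1).const_mul (a 2))).congr_deriv ?_
    simp; ring
  have hξ2 : ∀ z ∈ D, partialX (partialX ξ) z = a 2 * 2 := fun z hz => by
    rw [partialX_congr hDo hξ1 hz]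
    refine partialX_comp_fst (h := fun x => a 1 + a 2 * 2 * x) ?_
    exact (((hasDerivAt_id' z.1).const_mul (a 2 * 2)).const_add (a 1)).congr_deriv (by simp)
  set g : ℝ := ((N : ℝ) - 1) * a 2 with hg
  have hlin (x : ℝ) : HasDerivAt (fun x => g * x) g x := by
    simpa using (hasDerivAt_id' x).const_mul g
  have hlins : ContDiff ℝ ∞ (fun z : Plane => g * z.1) := by fun_prop
  obtain ⟨d, hd⟩ := exists_const_of_partial_eq_zero
    ((hηs.partialY hDo).sub hlins.contDiffOn) hDo hD
    (fun z hz => by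
      change partialX (fun z => partialY η z - _) z = 0
      rw [partialX_sub ((hηs.partialY hDo).differentiableAt_of_isOpen hDo hz)
        (hlins.differentiable (by simp) z), partialX_comp_fst (hlin z.1)]
      have := hηxy z hz
      rw [hξ2 z hz] at this
      linarith)
    (fun z hz => by
      change partialY (fun z => partialY η z - _) z = 0
      rw [partialY_sub ((hηs.partialY hDo).differentiableAt_of_isOpen hDo hz)
        (hlins.differentiable (by simp) z), partialY_comp_fst (hlin z.1), hηyy z hz, sub_self])
  have hd' : ∀ z ∈ D, partialY η z = g * z.1 + d := fun z hz => by
    have : partialY η z - g * z.1 = d := hd z hz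
    linarith
  have haff (x : ℝ) : HasDerivAt (fun x => g * x + d) g x := (hlin x).add_const d
  have hqs : ContDiff ℝ ∞ (fun z : Plane => (g * z.1 + d) * z.2) := by fun_prop
  obtain ⟨c, hc⟩ := exists_polynomial_of_partial_eq_zero hDo hD N
    (fun z => η z - (g * z.1 + d) * z.2) (hηs.sub hqs.contDiffOn)
    (fun z hz => by
      rw [partialY_sub (hηs.differentiableAt_of_isOpen hDo hz)
        (hqs.differentiable (by simp) z), partialY_mul_snd (haff z.1), hd' z hz, sub_self])
    (by
      rintro ⟨x, y⟩ hz
      rw [iterate_partialX_eq_iteratedDeriv hDo (hηs.sub hqs.contDiffOn) N x y hz]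
      have hs : ContDiffAt ℝ ∞ (fun t => η (t, y)) x :=
        hηs.along_graph (u := fun _ => y) hDo contDiff_const hz
      have hle : ((N : ℕ) : WithTop ℕ∞) ≤ ∞ := by exact_mod_cast le_top
      have e := iteratedDeriv_sub (n := N) (x := x) (f := fun t => η (t, y))
        (g := fun t => (C (g * y) * X + C (d * y)).eval t) (hs.of_le hle)
        ((contDiff_polynomial _).contDiffAt.of_le hle)
      rw [iteratedDeriv_polynomial_eq_zero (degree_linear_le.trans_lt
          (Nat.cast_lt.2 (by omega : 1 < N))) le_rfl,
        ← iterate_partialX_eq_iteratedDeriv hDo hηs N x y hz, hηx _ hz, sub_zero] at e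
      rw [← e]
      congr 1
      funext t
      simp
      ring)
  refine ⟨a, d, c, fun z hz => Prod.ext (ha' z hz) ?_⟩
  have := hc z hz
  change η z = _
  simp only at this ⊢
  linarith

end

/-! ### The canonical algebra and the symmetries of `y⁽ᴺ⁾ = 0` -/

theorem coordField_apply {D : Opens Plane} {ξ η : Plane → ℝ} (hξ : ContDiff ℝ ∞ ξ)
    (hη : ContDiff ℝ ∞ η) {z : Plane} (hz : z ∈ D) : coordField D ξ η hξ hη z = (ξ z, η z) :=
  PlaneField.ofFun_apply _ _ hz

section

open Polynomial

variable {D : Opens Plane} {N : ℕ}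

theorem characteristic_add (v w : PlaneField D) (u : ℝ → ℝ) :
    characteristic (v + w : PlaneField D) u = characteristic v u + characteristic w u := by
  funext x
  change ((v (x, u x)).2 + (w (x, u x)).2) - ((v (x, u x)).1 + (w (x, u x)).1) * deriv u x
    = ((v (x, u x)).2 - (v (x, u x)).1 * deriv u x)
      + ((w (x, u x)).2 - (w (x, u x)).1 * deriv u x)
  ring

theorem characteristic_smul (c : ℝ) (v : PlaneField D) (u : ℝ → ℝ) :
    characteristic (c • v : PlaneField D) u = fun x => c * characteristic v u x := by
  funext x
  change c * (v (x, u x)).2 - c * (v (x, u x)).1 * deriv u x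
    = c * ((v (x, u x)).2 - (v (x, u x)).1 * deriv u x)
  ring

/-- The symmetries of `y⁽ᴺ⁾ = 0` as a linear space. -/
def pointSymmetriesSubmodule (N : ℕ) (D : Opens Plane) : Submodule ℝ (PlaneField D) where
  carrier := pointSymmetries N D
  zero_mem' := mem_pointSymmetries_iff.2 fun P _ x _ => by
    have : characteristic (0 : PlaneField D) (fun x => P.eval x) = fun _ => 0 := by
      funext x; simp [characteristic]
    rw [this]
    simp
  add_mem' {v w} hv hw := mem_pointSymmetries_iff.2 fun P hP x hx => by
    have hle : ((N : ℕ) : WithTop ℕ∞) ≤ ∞ := by exact_mod_cast le_top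
    rw [characteristic_add, iteratedDeriv_add
      ((PlaneField.contDiffAt_characteristic v (contDiff_polynomial P) hx).of_le hle)
      ((PlaneField.contDiffAt_characteristic w (contDiff_polynomial P) hx).of_le hle),
      mem_pointSymmetries_iff.1 hv P hP x hx, mem_pointSymmetries_iff.1 hw P hP x hx, add_zero]
  smul_mem' c {v} hv := mem_pointSymmetries_iff.2 fun P hP x hx => by
    rw [characteristic_smul, iteratedDeriv_const_mul_field,
      mem_pointSymmetries_iff.1 hv P hP x hx, mul_zero]

theorem characteristic_coordField_eq {ξ η : Plane → ℝ} (hξ : ContDiff ℝ ∞ ξ) (hη : ContDiff ℝ ∞ η)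
    {u : ℝ → ℝ} {x : ℝ} (hx : (x, u x) ∈ D) :
    characteristic (coordField D ξ η hξ hη) u x = η (x, u x) - ξ (x, u x) * deriv u x := by
  rw [characteristic, coordField_apply hξ hη hx]

/-- A field whose characteristic along solutions is again a solution is a symmetry. -/
theorem coordField_mem_pointSymmetries {ξ η : Plane → ℝ} (hξ : ContDiff ℝ ∞ ξ)
    (hη : ContDiff ℝ ∞ η) (h : ∀ P : ℝ[X], P.degree < N → ∃ R : ℝ[X], R.degree < N ∧
      ∀ x, η (x, P.eval x) - ξ (x, P.eval x) * P.derivative.eval x = R.eval x) :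
    coordField D ξ η hξ hη ∈ pointSymmetries N D := by
  refine mem_pointSymmetries_iff.2 fun P hP x hx => ?_
  obtain ⟨R, hR, hPR⟩ := h P hP
  rw [← iteratedDeriv_polynomial_eq_zero hR le_rfl x]
  refine EventuallyEq.iteratedDeriv_eq N ?_
  filter_upwards [eventually_graph_mem D.isOpen (contDiff_polynomial P).continuous hx] with t ht
  rw [characteristic_coordField_eq hξ hη ht, ← hPR t, Polynomial.deriv]

/-- The projective field `x² ∂x + (N - 1) x y ∂y` preserves polynomials of degree less than `N`:
the coefficients of `xᴺ` in `(N - 1) x P` and in `x² P'` agree. -/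
theorem degree_projective_lt (hN : 2 ≤ N) {P : ℝ[X]} (hP : P.degree < N) :
    (C ((N : ℝ) - 1) * (X * P) - X * (X * derivative P)).degree < (N : WithBot ℕ) := by
  refine (degree_lt_iff_coeff_zero _ _).2 fun m hm => ?_
  have hP' := (degree_lt_iff_coeff_zero _ _).1 hP
  obtain ⟨k, rfl⟩ : ∃ k, m = k + 2 := ⟨m - 2, by omega⟩
  rw [coeff_sub, coeff_C_mul, coeff_X_mul, coeff_X_mul, coeff_X_mul, coeff_derivative]
  rcases hm.lt_or_eq with h | h
  · rw [hP' (k + 1) (by omega)]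
    simp
  · rw [h]
    push_cast
    ring

theorem canonical_le_pointSymmetries (hN : 2 ≤ N) :
    canonicalLevi N D ⊔ canonicalRadical N D ≤ pointSymmetriesSubmodule N D := by
  have hder {P : ℝ[X]} (hP : P.degree < N) : (derivative P).degree < N :=
    degree_derivative_le.trans_lt hP
  refine sup_le (Submodule.span_le.2 ?_) (Submodule.span_le.2 ?_)
  · rintro _ (rfl | rfl | rfl)
    · exact coordField_mem_pointSymmetries _ _ fun P hP =>
        ⟨-derivative P, by rw [degree_neg]; exact hder hP, fun x => by simp⟩
    · exact coordField_mem_pointSymmetries _ _ fun P hP =>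
        ⟨_, degree_projective_lt hN hP, fun x => by simp; ring⟩
    · refine coordField_mem_pointSymmetries _ _ fun P hP =>
        ⟨C ((N : ℝ) - 1) * P - C 2 * (X * derivative P), ?_, fun x => by simp; ring⟩
      refine (degree_lt_iff_coeff_zero _ _).2 fun m hm => ?_
      have hP' := (degree_lt_iff_coeff_zero _ _).1 hP
      obtain ⟨k, rfl⟩ : ∃ k, m = k + 1 := ⟨m - 1, by omega⟩
      rw [coeff_sub, coeff_C_mul, coeff_C_mul, coeff_X_mul, coeff_derivative, hP' (k + 1) hm]
      simp
  · rintro _ (rfl | ⟨i, rfl⟩)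
    · exact coordField_mem_pointSymmetries _ _ fun P hP => ⟨P, hP, fun x => by simp⟩
    · exact coordField_mem_pointSymmetries _ _ fun P _ =>
        ⟨X ^ (i : ℕ), by rw [degree_X_pow]; exact Nat.cast_lt.2 i.2, fun x => by simp⟩

/-- `p(x) ∂y` with `p` a combination of `1, …, xᴺ⁻¹` belongs to the canonical radical. -/
theorem mem_canonicalRadical_of_eq {w : PlaneField D} (d : ℝ) (c : ℕ → ℝ)
    (hw : ∀ z ∈ D, w z = (0, d * z.2 + ∑ i ∈ Finset.range N, c i * z.1 ^ i)) :
    w ∈ canonicalRadical N D := by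
  have hy : coordField D (fun _ => 0) (fun z => z.2) (by fun_prop) (by fun_prop)
      ∈ canonicalRadical N D := Submodule.subset_span (mem_insert _ _)
  have hx (i : Fin N) : coordField D (fun _ => 0) (fun z => z.1 ^ (i : ℕ)) (by fun_prop)
      (by fun_prop) ∈ canonicalRadical N D :=
    Submodule.subset_span (mem_insert_of_mem _ ⟨i, rfl⟩)
  have : w = d • coordField D (fun _ => 0) (fun z => z.2) (by fun_prop) (by fun_prop)
      + ∑ i : Fin N, c i • coordField D (fun _ => 0) (fun z => z.1 ^ (i : ℕ)) (by fun_prop)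
          (by fun_prop) := by
    refine PlaneField.ext_on fun z hz => ?_
    have he (v : PlaneField D) : v z = PlaneField.evalAt D z v := rfl
    have e₁ (i : Fin N) : coordField D (fun _ => 0) (fun z => z.1 ^ (i : ℕ)) (by fun_prop)
        (by fun_prop) z = (0, z.1 ^ (i : ℕ)) := coordField_apply _ _ hz
    rw [he (_ + _), map_add, map_sum, map_smul, Finset.sum_congr rfl fun (i : Fin N) _ =>
      (map_smul (PlaneField.evalAt D z) _ _).trans (congrArg (c (i : ℕ) • ·) (e₁ i)), ← he,
      coordField_apply _ _ hz, hw z hz, Finset.sum_range]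
    ext
    · simp [Prod.fst_sum]
    · simp [Prod.snd_sum]
  rw [this]
  exact Submodule.add_mem _ (Submodule.smul_mem _ _ hy)
    (Submodule.sum_mem _ fun i _ => Submodule.smul_mem _ _ (hx i))

theorem canonical_eq_pointSymmetries (hD : IsPreconnected (D : Set Plane)) (hN : 3 ≤ N) :
    canonicalLevi N D ⊔ canonicalRadical N D = pointSymmetriesSubmodule N D := by
  refine le_antisymm (canonical_le_pointSymmetries (by omega)) fun w hw => ?_
  obtain ⟨a, d, c, h⟩ := exists_eq_of_mem_pointSymmetries hD hN hw
  set f₁ := coordField D (fun _ => 1) (fun _ => 0) (by fun_prop) (by fun_prop) with hf₁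
  set f₂ := coordField D (fun z => z.1 ^ 2) (fun z => ((N : ℝ) - 1) * (z.1 * z.2))
      (by fun_prop) (by fun_prop) with hf₂
  set f₃ := coordField D (fun z => 2 * z.1) (fun z => ((N : ℝ) - 1) * z.2)
      (by fun_prop) (by fun_prop) with hf₃
  have m₁ : f₁ ∈ canonicalLevi N D := Submodule.subset_span (by simp [f₁])
  have m₂ : f₂ ∈ canonicalLevi N D := Submodule.subset_span (by simp [f₂])
  have m₃ : f₃ ∈ canonicalLevi N D := Submodule.subset_span (by simp [f₃])
  set s : PlaneField D := a 0 • f₁ + a 2 • f₂ + (a 1 / 2) • f₃ with hs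
  have hsm : s ∈ canonicalLevi N D := Submodule.add_mem _ (Submodule.add_mem _
    (Submodule.smul_mem _ _ m₁) (Submodule.smul_mem _ _ m₂)) (Submodule.smul_mem _ _ m₃)
  have hr : w - s ∈ canonicalRadical N D := by
    refine mem_canonicalRadical_of_eq (d - a 1 / 2 * ((N : ℝ) - 1)) c fun z hz => ?_
    change w z - (a 0 • f₁ z + a 2 • f₂ z + (a 1 / 2) • f₃ z) = _
    rw [h z hz, hf₁, hf₂, hf₃, coordField_apply _ _ hz, coordField_apply _ _ hz,
      coordField_apply _ _ hz]
    ext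
    · simp
      ring
    · simp
      ring
  rw [← add_sub_cancel s w]
  exact Submodule.add_mem _ (Submodule.mem_sup_left hsm) (Submodule.mem_sup_right hr)

/-- Three fields of the canonical form span the canonical Levi factor. -/
theorem span_eq_canonicalLevi {X Y H : PlaneField D} (hX : ∀ z ∈ D, X z = (1, 0))
    (hY : ∀ z ∈ D, Y z = (-z.1 ^ 2, -((N : ℝ) - 1) * (z.1 * z.2)))
    (hH : ∀ z ∈ D, H z = (-2 * z.1, -((N : ℝ) - 1) * z.2)) :
    Submodule.span ℝ {X, Y, H} = canonicalLevi N D := by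
  set f₁ := coordField D (fun _ => 1) (fun _ => 0) (by fun_prop) (by fun_prop) with hf₁
  set f₂ := coordField D (fun z => z.1 ^ 2) (fun z => ((N : ℝ) - 1) * (z.1 * z.2))
      (by fun_prop) (by fun_prop) with hf₂
  set f₃ := coordField D (fun z => 2 * z.1) (fun z => ((N : ℝ) - 1) * z.2)
      (by fun_prop) (by fun_prop) with hf₃
  have e₁ : X = f₁ := PlaneField.ext_on fun z hz => by rw [hX z hz, hf₁, coordField_apply _ _ hz]
  have e₂ : Y = -f₂ := PlaneField.ext_on fun z hz => by
    change Y z = -(f₂ z)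
    rw [hY z hz, hf₂, coordField_apply _ _ hz]
    ext <;> simp; ring
  have e₃ : H = -f₃ := PlaneField.ext_on fun z hz => by
    change H z = -(f₃ z)
    rw [hH z hz, hf₃, coordField_apply _ _ hz]
    ext <;> simp; ring
  change _ = Submodule.span ℝ {f₁, f₂, f₃}
  rw [e₁, e₂, e₃]
  refine le_antisymm (Submodule.span_le.2 ?_) (Submodule.span_le.2 ?_)
  · rintro _ (rfl | rfl | rfl)
    · exact Submodule.subset_span (by simp)
    · exact Submodule.neg_mem _ (Submodule.subset_span (by simp))
    · exact Submodule.neg_mem _ (Submodule.subset_span (by simp))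
  · rintro _ (rfl | rfl | rfl)
    · exact Submodule.subset_span (by simp)
    · exact (Submodule.neg_mem_iff _).1 (Submodule.subset_span (by simp))
    · exact (Submodule.neg_mem_iff _).1 (Submodule.subset_span (by simp))

/-- Nonzero multiples of `xⁱ ∂y`, `i < N`, together with one of `y ∂y` span the canonical
radical. -/
theorem span_sup_span_eq_canonicalRadical {v : Fin N → PlaneField D} {Z : PlaneField D}
    {c : Fin N → ℝ} (hc : ∀ i, c i ≠ 0) (hv : ∀ i, ∀ z ∈ D, v i z = (0, c i * z.1 ^ (i : ℕ)))
    {d : ℝ} (hd : d ≠ 0) (hZ : ∀ z ∈ D, Z z = (0, d * z.2)) :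
    Submodule.span ℝ (range v) ⊔ Submodule.span ℝ {Z} = canonicalRadical N D := by
  have ev (i : Fin N) : v i = c i • coordField D (fun _ => 0) (fun z => z.1 ^ (i : ℕ))
      (by fun_prop) (by fun_prop) := PlaneField.ext_on fun z hz => by
    change v i z = c i • coordField D _ _ _ _ z
    rw [hv i z hz, coordField_apply _ _ hz]
    simp
  have eZ : Z = d • coordField D (fun _ => 0) (fun z => z.2) (by fun_prop) (by fun_prop) :=
    PlaneField.ext_on fun z hz => by
      change Z z = d • coordField D _ _ _ _ z
      rw [hZ z hz, coordField_apply _ _ hz]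
      simp
  refine le_antisymm (sup_le (Submodule.span_le.2 ?_) (Submodule.span_le.2 ?_))
    (Submodule.span_le.2 ?_)
  · rintro _ ⟨i, rfl⟩
    rw [ev]
    exact Submodule.smul_mem _ _ (Submodule.subset_span (mem_insert_of_mem _ ⟨i, rfl⟩))
  · rintro _ rfl
    rw [eZ]
    exact Submodule.smul_mem _ _ (Submodule.subset_span (mem_insert _ _))
  · rintro _ (rfl | ⟨i, rfl⟩)
    · refine Submodule.mem_sup_right ((Submodule.smul_mem_iff _ hd).1 ?_)
      rw [← eZ]
      exact Submodule.mem_span_singleton_self Z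
    · refine Submodule.mem_sup_left ((Submodule.smul_mem_iff _ (hc i)).1 ?_)
      rw [← ev]
      exact Submodule.subset_span ⟨i, rfl⟩

/-! ### Invariant hypersurfaces -/

/-- Truncation of jets as a continuous linear map. -/
noncomputable def truncCLM {m n : ℕ} (h : m ≤ n) : JetCoords n →L[ℝ] JetCoords m :=
  (ContinuousLinearMap.fst ℝ ℝ (Fin n → ℝ)).prod
    (ContinuousLinearMap.pi fun i => (ContinuousLinearMap.proj (R := ℝ)
      (φ := fun _ : Fin n => ℝ) (Fin.castLE h i)).comp (ContinuousLinearMap.snd ℝ ℝ (Fin n → ℝ)))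

theorem fderiv_last_coord_sub {f : JetCoords N → ℝ} {j : JetCoords (N + 1)}
    (hf : DifferentiableAt ℝ f (j.trunc (Nat.le_succ N))) (a : JetCoords (N + 1)) :
    fderiv ℝ (fun i : JetCoords (N + 1) => i.2 (Fin.last N) - f (i.trunc (Nat.le_succ N))) j a
      = a.2 (Fin.last N) - fderiv ℝ f (j.trunc (Nat.le_succ N)) (a.trunc (Nat.le_succ N)) := by
  have h1 : HasFDerivAt (fun i : JetCoords (N + 1) => f (i.trunc (Nat.le_succ N)))
      ((fderiv ℝ f (j.trunc (Nat.le_succ N))).comp (truncCLM (Nat.le_succ N))) j :=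
    HasFDerivAt.comp j (f := JetCoords.trunc (Nat.le_succ N)) hf.hasFDerivAt
      (truncCLM (Nat.le_succ N)).hasFDerivAt
  have h2 : DifferentiableAt ℝ (fun i : JetCoords (N + 1) => i.2 (Fin.last N)) j := by fun_prop
  rw [fderiv_fun_sub h2 h1.differentiableAt, h1.fderiv, _root_.sub_apply, fderiv_last_coord]
  rfl

theorem isInvariantHypersurface_zero {w : PlaneField D} (hw : w ∈ pointSymmetries N D)
    {Ω : Set (JetCoords N)} (hΩ : IsOpen Ω)
    (hD : ∀ j : JetCoords (N + 1), j.trunc (Nat.le_succ N) ∈ Ω → j.base ∈ D)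
    {f : JetCoords N → ℝ} (hf : ∀ j ∈ Ω, f j = 0) : IsInvariantHypersurface w N Ω f := by
  intro j hj hjf
  rw [hf _ hj] at hjf
  rw [← hw j (hD j hj) hjf]
  have : (fun i : JetCoords (N + 1) => i.2 (Fin.last N) - f (i.trunc (Nat.le_succ N)))
      =ᶠ[𝓝 j] fun i => i.2 (Fin.last N) := by
    filter_upwards [(contDiff_trunc (Nat.le_succ N)).continuous.continuousAt.eventually
      (hΩ.mem_nhds hj)] with i hi
    rw [hf _ hi, sub_zero]
  rw [this.fderiv_eq]

/-- The prolongation of a vertical field along the graph of `u`. -/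
theorem prolong_jetOf_of_vertical {w : PlaneField D} (hw : ∀ z ∈ D, (w z).1 = 0) {u g : ℝ → ℝ}
    (hu : ContDiff ℝ ∞ u) {x : ℝ} (hx : (x, u x) ∈ D)
    (hg : ∀ t, (t, u t) ∈ D → (w (t, u t)).2 = g t) :
    prolong w N (jetOf (N + 1) u x) = ((0 : ℝ), fun k : Fin (N + 1) => iteratedDeriv k g x) := by
  refine Prod.ext ?_ (funext fun k => ?_)
  · change (w (jetOf (N + 1) u x).base).1 = 0
    rw [base_jetOf, hw _ hx]
  · change prolongCoeff w k (jetOf (k + 1) u x) = iteratedDeriv k g x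
    rw [PlaneField.prolongCoeff_jetOf w hu k x hx, hw _ hx, zero_mul, add_zero]
    refine EventuallyEq.iteratedDeriv_eq k ?_
    filter_upwards [eventually_graph_mem D.isOpen hu.continuous hx] with t ht
    rw [characteristic, hw _ ht, zero_mul, sub_zero, hg t ht]

/-- A hypersurface `y⁽ᴺ⁾ = f` invariant under the canonical radical is `y⁽ᴺ⁾ = 0`. At a jet `j`
with lower part `(x; a)`, invariance under `p(x) ∂y`, with `p` the polynomial of degree less than
`N` having jet `a`, says that the derivative of `f` in the direction `a` vanishes; invariance
under `y ∂y` says that this derivative is `f`. -/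
theorem eq_zero_of_isInvariantHypersurface {Ω : Set (JetCoords N)} (hΩ : IsOpen Ω)
    (hD : ∀ j : JetCoords (N + 1), j.trunc (Nat.le_succ N) ∈ Ω → j.base ∈ D)
    {f : JetCoords N → ℝ} (hf : DifferentiableOn ℝ f Ω)
    (h : ∀ w ∈ canonicalRadical N D, IsInvariantHypersurface w N Ω f) : ∀ j ∈ Ω, f j = 0 := by
  intro j hj
  obtain ⟨P, hP, hPj⟩ := exists_polynomial_iteratedDeriv_eq j.1
    (fun k => if h : k < N then j.2 ⟨k, h⟩ else 0) N
  obtain ⟨u, -, huj⟩ := exists_polynomial_iteratedDeriv_eq j.1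
    (fun k => if h : k < N then j.2 ⟨k, h⟩ else f j) (N + 1)
  have hPj' (k : Fin N) : iteratedDeriv k (fun x => P.eval x) j.1 = j.2 k := by
    rw [hPj k k.2, dif_pos k.2]
  have huj' (k : Fin N) : iteratedDeriv k (fun x => u.eval x) j.1 = j.2 k := by
    rw [huj k (Nat.lt_succ_of_lt k.2), dif_pos k.2]
  have huN : iteratedDeriv N (fun x => u.eval x) j.1 = f j := by
    rw [huj N (Nat.lt_succ_self N), dif_neg (lt_irrefl N)]
  set J : JetCoords (N + 1) := jetOf (N + 1) (fun x => u.eval x) j.1 with hJ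
  have hJt : J.trunc (Nat.le_succ N) = j := Prod.ext rfl (funext huj')
  have hx : (j.1, u.eval j.1) ∈ D := by
    have := hD J (hJt.symm ▸ hj)
    rwa [hJ, base_jetOf] at this
  have hfd : DifferentiableAt ℝ f (J.trunc (Nat.le_succ N)) := by
    rw [hJt]; exact hf.differentiableAt (hΩ.mem_nhds hj)
  have key (w : PlaneField D) (hw : w ∈ canonicalRadical N D) :
      (prolong w N J).2 (Fin.last N)
        - fderiv ℝ f j ((prolong w N J).trunc (Nat.le_succ N)) = 0 := by
    have := h w hw J (hJt.symm ▸ hj) (by rw [hJt]; exact huN)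
    rwa [fderiv_last_coord_sub hfd, hJt] at this
  have hPs : ContDiff ℝ ∞ (fun z : Plane => P.eval z.1) :=
    (contDiff_polynomial P).comp contDiff_fst
  have k1 := key (coordField D (fun _ => 0) (fun z => P.eval z.1) (by fun_prop) hPs)
    (mem_canonicalRadical_of_eq 0 P.coeff fun z hz => by
      rw [coordField_apply _ _ hz, zero_mul, zero_add]
      refine Prod.ext rfl ?_
      rcases eq_or_ne P 0 with h0 | h0
      · simp [h0]
      · exact eval_eq_sum_range' ((natDegree_lt_iff_degree_lt h0).2 hP) _)
  have k2 := key (coordField D (fun _ => 0) (fun z => z.2) (by fun_prop) (by fun_prop))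
    (Submodule.subset_span (mem_insert _ _))
  rw [hJ, prolong_jetOf_of_vertical (g := fun x => P.eval x)
    (fun z hz => by rw [coordField_apply _ _ hz]) (contDiff_polynomial u) hx
    (fun t ht => by rw [coordField_apply _ _ ht])] at k1
  rw [hJ, prolong_jetOf_of_vertical (g := fun x => u.eval x)
    (fun z hz => by rw [coordField_apply _ _ hz]) (contDiff_polynomial u) hx
    (fun t ht => by rw [coordField_apply _ _ ht])] at k2
  have t1 : JetCoords.trunc (Nat.le_succ N)
      ((0 : ℝ), fun k : Fin (N + 1) => iteratedDeriv k (fun x => P.eval x) j.1) = (0, j.2) :=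
    Prod.ext rfl (funext hPj')
  have t2 : JetCoords.trunc (Nat.le_succ N)
      ((0 : ℝ), fun k : Fin (N + 1) => iteratedDeriv k (fun x => u.eval x) j.1) = (0, j.2) :=
    Prod.ext rfl (funext huj')
  rw [t1] at k1
  rw [t2] at k2
  change iteratedDeriv N (fun x => P.eval x) j.1 - _ = 0 at k1
  change iteratedDeriv N (fun x => u.eval x) j.1 - _ = 0 at k2
  rw [iteratedDeriv_polynomial_eq_zero hP le_rfl] at k1
  rw [huN] at k2
  linarith

end

/-! ### Passage to canonical coordinates -/

/-- The elements of an algebra of fields, expressed in the coordinates `φ`. -/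
noncomputable def chartRep {U : Opens Plane} (A : LieSubalgebra ℝ (PlaneField U)) (φ : PlaneChart U) :
    A →ₗ[ℝ] PlaneField φ.domain :=
  φ.push ∘ₗ A.toSubmodule.subtype

theorem chartRep_lie {U : Opens Plane} (A : LieSubalgebra ℝ (PlaneField U)) (φ : PlaneChart U)
    (a b : A) : chartRep A φ ⁅a, b⁆ = ⁅chartRep A φ a, chartRep A φ b⁆ :=
  φ.push_lie a b

/-- A subspace of rank at most one containing `V = ∂y` consists of vertical fields. -/
theorem push_fst_eq_zero {U : Opens Plane} {φ : PlaneChart U} {L : Submodule ℝ (PlaneField U)}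
    (hL : PlaneField.rank L ≤ 1) {V r : PlaneField U} (hVL : V ∈ L) (hr : r ∈ L)
    (hV : ∀ z ∈ φ.domain, φ.push V z = (0, 1)) : ∀ z ∈ φ.domain, (φ.push r z).1 = 0 := by
  intro z hz
  have h1 := hV z hz
  rw [φ.push_apply V hz] at h1
  have hne : V (φ.toHomeo.symm z) ≠ 0 := by
    intro h0
    rw [h0, map_zero] at h1
    exact zero_ne_one (congrArg Prod.snd h1)
  obtain ⟨c, hc⟩ := PlaneField.exists_eq_smul_of_rank_le_one hL hVL hr
    (φ.source_subset (φ.symm_mem hz)) hne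
  rw [φ.push_apply r hz, hc, map_smul, h1]
  simp

theorem exists_eq_span_singleton_of_finrank_eq_one {M : Type*} [AddCommGroup M] [Module ℝ M]
    {K : Submodule ℝ M} (hK : Module.finrank ℝ K = 1) :
    ∃ z, z ≠ 0 ∧ K = Submodule.span ℝ {z} := by
  obtain ⟨⟨z, hz⟩, hz0, hspan⟩ := finrank_eq_one_iff'.1 hK
  refine ⟨z, fun h => hz0 (Subtype.ext h), le_antisymm (fun t ht => ?_) ?_⟩
  · obtain ⟨d, hd⟩ := hspan ⟨t, ht⟩
    exact Submodule.mem_span_singleton.2 ⟨d, congrArg Subtype.val hd⟩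
  · rwa [Submodule.span_singleton_le_iff_mem]

/-- In canonical coordinates in which `H` is linear, the Levi factor and the radical take the
canonical form. -/
theorem map_eq_canonical {U : Opens Plane} {A : LieSubalgebra ℝ (PlaneField U)} {N : ℕ}
    (hN : 2 ≤ N) {X Y H : A} (hsl : IsSl2Triple H X Y) {S : LieSubalgebra ℝ A}
    (hS : S.toSubmodule = Submodule.span ℝ {X, Y, H})
    {W T : LieSubmodule ℝ S A}
    (hWT : W.toSubmodule ⊔ T.toSubmodule = (LieAlgebra.radical ℝ A).toSubmodule)
    (hTdim : Module.finrank ℝ T = 1) {V : A} (hVW : V ∈ W)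
    (hWspan : W.toSubmodule = Submodule.span ℝ
      (range fun i : Fin N => (LieModule.toEnd ℝ A A Y ^ (i : ℕ)) V))
    (hR : PlaneField.rank
      ((LieAlgebra.radical ℝ A).toSubmodule.map A.toSubmodule.subtype) ≤ 1)
    {p : Plane} (hgerm : ∀ v ∈ A, (v : Plane → Plane) =ᶠ[𝓝 p] 0 → v = 0)
    {ψ : PlaneChart U} (hψc : IsConnected ψ.toHomeo.source) (hp : p ∈ ψ.toHomeo.source)
    (hψ : ψ.IsCanonical X V)
    (hH : ∀ z ∈ ψ.domain, chartRep A ψ H z = (-2 * z.1, -((N : ℝ) - 1) * z.2)) :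
    S.toSubmodule.map (chartRep A ψ) = canonicalLevi N ψ.domain ∧
      (LieAlgebra.radical ℝ A).toSubmodule.map (chartRep A ψ) = canonicalRadical N ψ.domain := by
  have hN2 : (2 : ℝ) ≤ N := by exact_mod_cast hN
  have hN0 : (N : ℝ) - 1 ≠ 0 := by linarith
  have hmem {a : A} (ha : a ∈ ({X, Y, H} : Set A)) : a ∈ S := by
    change a ∈ S.toSubmodule
    rw [hS]
    exact Submodule.subset_span ha
  have hD : IsPreconnected (ψ.domain : Set Plane) := ψ.isPreconnected_domain hψc
  have hΨX : ∀ z ∈ ψ.domain, chartRep A ψ X z = (1, 0) := fun z hz => (hψ z hz).1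
  have hΨV : ∀ z ∈ ψ.domain, chartRep A ψ V z = (0, 1) := fun z hz => (hψ z hz).2
  -- the trivial summand
  obtain ⟨Z, hZ0, hTspan⟩ := exists_eq_span_singleton_of_finrank_eq_one
    (K := T.toSubmodule) hTdim
  have hZT : Z ∈ T.toSubmodule := hTspan ▸ Submodule.mem_span_singleton_self Z
  have hZlie {a : A} (ha : a ∈ S) : ∃ d : ℝ, ⁅a, Z⁆ = d • Z := by
    have h1 : ⁅a, Z⁆ ∈ T.toSubmodule := T.lie_mem (x := (⟨a, ha⟩ : S)) hZT
    rw [hTspan] at h1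
    obtain ⟨d, hd⟩ := Submodule.mem_span_singleton.1 h1
    exact ⟨d, hd.symm⟩
  obtain ⟨dX, hdX⟩ := hZlie (hmem (a := X) (by simp))
  obtain ⟨dY, hdY⟩ := hZlie (hmem (a := Y) (by simp))
  obtain ⟨hHZ, hXZ, hYZ⟩ := hsl.lie_eq_zero_of_lie_eq_smul hdX hdY
  -- the radical is vertical
  have hWR : W.toSubmodule ≤ (LieAlgebra.radical ℝ A).toSubmodule := hWT ▸ le_sup_left
  have hTR : T.toSubmodule ≤ (LieAlgebra.radical ℝ A).toSubmodule := hWT ▸ le_sup_right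
  have hvert {r : A} (hr : r ∈ (LieAlgebra.radical ℝ A).toSubmodule) :
      ∀ z ∈ ψ.domain, (chartRep A ψ r z).1 = 0 :=
    push_fst_eq_zero (V := (V : PlaneField U)) (r := (r : PlaneField U)) hR ⟨V, hWR hVW, rfl⟩
      ⟨r, hr, rfl⟩ hΨV
  have hYV : ⁅Y, V⁆ ∈ W.toSubmodule :=
    W.lie_mem (x := (⟨Y, hmem (by simp)⟩ : S)) hVW
  have hΨZ : chartRep A ψ Z ≠ 0 := fun h => hZ0 (Subtype.ext
    (hgerm Z Z.2 (ψ.eventuallyEq_zero_of_push_eq_zero h hp)))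
  have lie0 {a b : A} (h : ⁅a, b⁆ = 0) : ⁅chartRep A ψ a, chartRep A ψ b⁆ = 0 := by
    rw [← chartRep_lie, h, map_zero]
  obtain ⟨hΨY, C, hC, hΨZ'⟩ := PlaneField.eq_of_relations (Y := chartRep A ψ Y) (Z := chartRep A ψ Z)
    hD hN0 hΨX hΨV hH
    (by rw [← chartRep_lie, hsl.lie_e_f])
    (by rw [← chartRep_lie, hsl.lie_lie_smul_f ℝ, map_neg, map_smul])
    (fun z hz => by
      rw [← chartRep_lie]
      exact hvert (hWR hYV) z hz)
    (hvert (hTR hZT)) (lie0 hXZ) (lie0 hHZ) (lie0 hYZ) hΨZ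
  constructor
  · rw [hS, Submodule.map_span, image_insert_eq, image_pair]
    exact span_eq_canonicalLevi hΨX hΨY hH
  · rw [← hWT, Submodule.map_sup, hWspan, hTspan, Submodule.map_span, Submodule.map_span,
      image_singleton, ← range_comp]
    have horb := PlaneField.lowering_orbit hΨV hΨY
      (fun i => chartRep A ψ ((LieModule.toEnd ℝ A A Y ^ i) V)) (by simp)
      (fun i => by
        rw [← chartRep_lie, pow_succ']
        rfl)
    refine span_sup_span_eq_canonicalRadical (c := fun i => ∏ j ∈ Finset.range i, ((N : ℝ) - 1 - j))
      (fun i => Finset.prod_ne_zero_iff.2 fun j hj => ?_) (fun i => horb i) hC hΨZ'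
    have h1 : j + 1 < N := by have := Finset.mem_range.1 hj; omega
    have h2 : (j : ℝ) + 1 < N := by exact_mod_cast h1
    linarith
/-- In canonical coordinates, after a translation centring `H`, the Levi factor and the radical
take the canonical form. -/
theorem exists_translate_canonical {U : Opens Plane} {A : LieSubalgebra ℝ (PlaneField U)} {N : ℕ}
    (hN : 2 ≤ N) {X Y H : A} (hsl : IsSl2Triple H X Y) {S : LieSubalgebra ℝ A}
    (hS : S.toSubmodule = Submodule.span ℝ {X, Y, H})
    (hLevi : IsCompl S.toSubmodule (LieAlgebra.radical ℝ A).toSubmodule)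
    {W T : LieSubmodule ℝ S A}
    (hWT : W.toSubmodule ⊔ T.toSubmodule = (LieAlgebra.radical ℝ A).toSubmodule)
    (hW : LieModule.IsIrreducible ℝ S W) (hWdim : Module.finrank ℝ W = N)
    (hTdim : Module.finrank ℝ T = 1)
    {V : A} (hVW : V ∈ W) {μ : ℝ} (hV : hsl.HasPrimitiveVectorWith V μ)
    (hR : PlaneField.rank
      ((LieAlgebra.radical ℝ A).toSubmodule.map A.toSubmodule.subtype) ≤ 1)
    {p : Plane} (hgerm : ∀ v ∈ A, (v : Plane → Plane) =ᶠ[𝓝 p] 0 → v = 0)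
    {φ : PlaneChart U} (hφc : IsConnected φ.toHomeo.source) (hp : p ∈ φ.toHomeo.source)
    (hφ : φ.IsCanonical X V) :
    ∃ c : Plane, S.toSubmodule.map (chartRep A (φ.translate c))
        = canonicalLevi N (φ.translate c).domain ∧
      (LieAlgebra.radical ℝ A).toSubmodule.map (chartRep A (φ.translate c))
        = canonicalRadical N (φ.translate c).domain := by
  -- finite-dimensionality and the weight of `V`
  have hWfin : Module.Finite ℝ W.toSubmodule :=
    Module.finite_of_finrank_pos (by change 0 < Module.finrank ℝ W; omega)
  have hTfin : Module.Finite ℝ T.toSubmodule :=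
    Module.finite_of_finrank_pos (by change 0 < Module.finrank ℝ T; omega)
  have hfin : Module.Finite ℝ A := by
    refine ⟨?_⟩
    rw [← hLevi.sup_eq_top, ← hWT, hS]
    exact (Submodule.fg_span (by simp)).sup
      ((Module.Finite.iff_fg.1 hWfin).sup (Module.Finite.iff_fg.1 hTfin))
  obtain ⟨hμ, hWspan⟩ := hsl.weight_eq_and_eq_span hS hV hW hVW
  rw [hWdim] at hμ hWspan
  have hN2 : (2 : ℝ) ≤ N := by exact_mod_cast hN
  have hμ0 : μ ≠ 0 := by rw [hμ]; linarith
  -- the affine form of `H`, and the translation that makes it linear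
  obtain ⟨c₀, hc₀⟩ := PlaneField.exists_eq_affine (H := chartRep A φ H) (lam := 2) (μ := μ)
    (φ.isPreconnected_domain hφc) (fun z hz => (hφ z hz).1) (fun z hz => (hφ z hz).2)
    (by
      have := congrArg (chartRep A φ) (hsl.lie_h_e_smul ℝ)
      rwa [chartRep_lie, map_smul] at this)
    (by
      have := congrArg (chartRep A φ) hV.lie_h
      rwa [chartRep_lie, map_smul] at this)
  set c : Plane := (-c₀.1 / 2, -c₀.2 / μ) with hc
  refine ⟨c, map_eq_canonical hN hsl hS hWT hTdim hVW hWspan hR hgerm (ψ := φ.translate c)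
    hφc hp (φ.isCanonical_translate hφ c) fun z hz => ?_⟩
  have h1 : chartRep A (φ.translate c) H z = chartRep A φ H (z - c) := φ.push_translate c H hz
  rw [h1, hc₀ _ ((φ.translate_domain c).1 hz), hc, ← hμ]
  ext
  · simp; ring
  · simp; field_simp; ring

theorem theorem3p4 (U : Opens Plane) (A : LieSubalgebra ℝ (PlaneField U)) (N : ℕ) (hN : 2 ≤ N)
    -- the standard basis of a Levi complement `S` of the radical
    (X Y H : A) (hsl : IsSl2Triple H X Y)
    (S : LieSubalgebra ℝ A) (hS : S.toSubmodule = Submodule.span ℝ {X, Y, H})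
    (hLevi : IsCompl S.toSubmodule (LieAlgebra.radical ℝ A).toSubmodule)
    -- the radical is `W ⊕ T` as a representation of `S`
    (W T : LieSubmodule ℝ S A)
    (hWT : W.toSubmodule ⊔ T.toSubmodule = (LieAlgebra.radical ℝ A).toSubmodule)
    (hdisj : Disjoint W.toSubmodule T.toSubmodule)
    (hW : LieModule.IsIrreducible ℝ S W) (hWdim : Module.finrank ℝ W = N)
    (hTdim : Module.finrank ℝ T = 1)
    -- a highest weight vector of `W` relative to `⟨H, X⟩`
    (V : A) (hVW : V ∈ W) (hV : ∃ μ : ℝ, hsl.HasPrimitiveVectorWith V μ)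
    -- the rank conditions
    (hR : PlaneField.rank
      ((LieAlgebra.radical ℝ A).toSubmodule.map A.toSubmodule.subtype) = 1)
    (hXV : PlaneField.rank (Submodule.span ℝ {(X : PlaneField U), (V : PlaneField U)}) = 2)
    -- a point where `X`, `V` are independent and at which the elements of `A` are determined
    -- by their germs
    (p : Plane) (hp : p ∈ U) (hind : LinearIndependent ℝ ![X.1 p, V.1 p])
    (hgerm : ∀ v ∈ A, (v : Plane → Plane) =ᶠ[𝓝 p] 0 → v = 0) :
    -- canonical coordinates exist near `p`
    (∃ φ : PlaneChart U, IsConnected φ.toHomeo.source ∧ p ∈ φ.toHomeo.source ∧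
      φ.IsCanonical X V) ∧
    -- and any of them, after an affine change, have the asserted properties
    ∀ φ : PlaneChart U, IsConnected φ.toHomeo.source → p ∈ φ.toHomeo.source →
      φ.IsCanonical X V →
      ∃ c : Plane, ∃ ψ : PlaneChart U, ψ = φ.translate c ∧
        (S.toSubmodule.map A.toSubmodule.subtype).map ψ.push = canonicalLevi N ψ.domain ∧
        ((LieAlgebra.radical ℝ A).toSubmodule.map A.toSubmodule.subtype).map ψ.push
          = canonicalRadical N ψ.domain ∧
        (3 ≤ N → (A.toSubmodule.map ψ.push : Set (PlaneField ψ.domain))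
          = pointSymmetries N ψ.domain) ∧
        ∀ (Ω : Set (JetCoords N)) (f : JetCoords N → ℝ), IsOpen Ω →
          (∀ j : JetCoords (N + 1), j.trunc (Nat.le_succ N) ∈ Ω → j.base ∈ ψ.domain) →
          DifferentiableOn ℝ f Ω →
          ((∀ v ∈ A, IsInvariantHypersurface (ψ.push v) N Ω f) ↔ ∀ j ∈ Ω, f j = 0) := by

  obtain ⟨μ, hμ⟩ := hV
  refine ⟨exists_isCanonical (X : PlaneField U) V hp hind
    (congrArg Subtype.val hμ.lie_e), fun φ hφc hpφ hφ => ?_⟩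
  obtain ⟨c, hL, hRad⟩ := exists_translate_canonical hN hsl hS hLevi hWT hW hWdim hTdim hVW hμ
    hR.le hgerm hφc hpφ hφ
  set ψ := φ.translate c with hψ
  have hA : A.toSubmodule.map ψ.push
      = canonicalLevi N ψ.domain ⊔ canonicalRadical N ψ.domain := by
    rw [← hL, ← hRad, ← Submodule.map_sup, hLevi.sup_eq_top, chartRep, Submodule.map_comp,
      Submodule.map_subtype_top]
  refine ⟨c, ψ, rfl, ?_, ?_, fun hN3 => ?_, fun Ω f hΩ hΩD hf => ⟨fun h => ?_, fun h v hv => ?_⟩⟩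
  · rw [← hL, chartRep, Submodule.map_comp]
  · rw [← hRad, chartRep, Submodule.map_comp]
  · rw [hA, canonical_eq_pointSymmetries (ψ.isPreconnected_domain hφc) hN3]
    rfl
  · refine eq_zero_of_isInvariantHypersurface hΩ hΩD hf fun w hw => ?_
    obtain ⟨v, hv, rfl⟩ : w ∈ A.toSubmodule.map ψ.push := hA ▸ Submodule.mem_sup_right hw
    exact h v hv
  · refine isInvariantHypersurface_zero (canonical_le_pointSymmetries hN ?_) hΩ hΩD h
    rw [← hA]
    exact Submodule.mem_map_of_mem hv
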